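/- Let $\mathbb{K}$ be an algebraically closed field of characteristic $0$; all functors are additive and $\mathbb{K}$-linear. A finite crossed module $\mathcal{X}=(G,X,\partial)$ consists of finite groups $G,X$, an action $(g,x)\mapsto {}^g x$ of $G$ on $X$ by automorphisms and a homomorphism $\partial:X\to G$ with ${}^{\partial(x)}x'=xx'x^{-1}$ and $\partial({}^g x)=g\partial(x)g^{-1}$. A homomorphism $(f,F):(G,X,\partial)\to(G',X',\partial')$ is a pair of group homomorphisms $f:G\to G'$, $F:X\to X'$ with $\partial' F=f\partial$ and $F({}^g x)={}^{f(g)}F(x)$; it is an isomorphism if $f$ and $F$ are. A quasi-abelian $3$-cocycle on $\mathcal{X}$ is a quadruple $(\omega,\gamma,\mu,c)$ of $\mathbb{K}^\times$-valued functions $\omega(x,y,z)$, $\gamma_{g,h}(x)$, $\mu_g(x,y)$, $c(x,y)$ ($g,h\in G$, $x,y,z\in X$) such that, for all $g,h,k\in G$ and $w,x,y,z\in X$, $$\omega(x,y,z)\,\omega(w,xy,z)\,\omega(w,x,y)=\omega(w,x,yz)\,\omega(wx,y,z),\qquad \gamma_{h,k}(x)\gamma_{g,hk}(x)=\gamma_{g,h}({}^k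 x)\gamma_{gh,k}(x),$$ $$\frac{\mu_g(y,z)\mu_g(x,yz)}{\mu_g(xy,z)\mu_g(x,y)}=\frac{\omega({}^g x,{}^g y,{}^g z)}{\omega(x,y,z)},\qquad \frac{\gamma_{g,h}(x)\gamma_{g,h}(y)}{\gamma_{g,h}(xy)}=\frac{\mu_g({}^h x,{}^h y)\mu_h(x,y)}{\mu_{gh}(x,y)},$$ $$\frac{c({}^g x,{}^g y)}{c(x,y)}=\frac{\mu_g(xyx^{-1},x)}{\mu_g(x,y)}\,\frac{\gamma_{g\partial(x)g^{-1},g}(y)}{\gamma_{g,\partial(x)}(y)},$$ $$c(xy,z)=\frac{\omega(x,y,z)\,\omega((xy)z(xy)^{-1},x,y)}{\omega(x,yzy^{-1},y)\,\gamma_{\partial(x),\partial(y)}(z)}\,c(x,yzy^{-1})\,c(y,z),$$ $$c(x,yz)=\frac{\omega(xyx^{-1},x,z)}{\omega(x,y,z)\,\omega(xyx^{-1},xzx^{-1},x)\,\mu_{\partial(x)}(y,z)}\,c(x,y)\,c(x,z).$$ These form a group $Z^3_{qa}(\mathcal{X},\mathbb{K}^\times)$ under pointwise multiplication. For arbitrary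 functions $\eta:X\times X\to\mathbb{K}^\times$ and $\beta:G\times X\to\mathbb{K}^\times$, $(g,x)\mapsto\beta_g(x)$, the quadruple with components $$\frac{\eta(y,z)\eta(x,yz)}{\eta(xy,z)\eta(x,y)},\quad \frac{\beta_g({}^h x)\beta_h(x)}{\beta_{gh}(x)},\quad \frac{\beta_g(x)\beta_g(y)}{\beta_g(xy)}\,\frac{\eta({}^g x,{}^g y)}{\eta(x,y)},\quad \beta_{\partial(x)}(y)\,\frac{\eta(xyx^{-1},x)}{\eta(x,y)}$$ is a coboundary; these form a subgroup $B^3_{qa}(\mathcal{X},\mathbb{K}^\times)$, and $H^3_{qa}=Z^3_{qa}/B^3_{qa}$. Two cocycles are cohomologous if they have the same class in $H^3_{qa}$. The pullback $(\omega',\gamma',\mu',c')^{(f,F)}$ is obtained by substituting $f(g)$ for the arguments in $G'$ and $F(x)$ for those in $X'$. Given a quasi-abelian $3$-cocycle $(\omega,\gamma,\mu,c)$ on $\mathcal{X}$, let $\mathcal{C}(\omega,\gamma,\mu,c)$ be the following crossed (that is, braided $G$-crossed) category. Its underlying tensor category is $\mathrm{Vec}_X^\omega$: finite-dimensional $X$-graded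 vector spaces, with associativity $(u\otimes v)\otimes w\mapsto\omega(x,y,z)\,u\otimes(v\otimes w)$ and unit constraints $1\otimes v\mapsto\omega(e,e,x)^{-1}v$, $v\otimes 1\mapsto\omega(x,e,e)v$ on homogeneous elements of degrees $x,y,z$ (resp. $x$). Its $G$-grading has $\mathcal{C}_g$ the objects supported on $\partial^{-1}(g)$. The functor $T_g$ keeps the vector space and replaces the degree $x$ by ${}^g x$; its tensor structure $T_g(V\otimes W)\to T_g(V)\otimes T_g(W)$ is $\mu_g(x,y)\,\mathrm{id}$ and its unit structure $T_g(1)\to 1$ is $\mu_g(e,e)^{-1}$. The action constraints $T_{gh}\to T_gT_h$ and $T_e\to\mathrm{id}$ are $\gamma_{g,h}(x)\,\mathrm{id}$ and $\gamma_{e,e}(x)^{-1}\,\mathrm{id}$. The $G$-braiding $V\otimes W\to T_{\partial(x)}(W)\otimes V$ is $v\otimes w\mapsto c(x,y)\,w\otimes v$ for $v,w$ of degrees $x,y$. A crossed tensor functor from a $G$-crossed category $\mathcal{C}$ to a $G'$-crossed category $\mathcal{C}'$ consists of a homomorphism $f:G\to G'$, a tensor functor $(F,\eta,\eta_0):\mathcal{C}\to\mathcal{C}'$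 with $F(\mathcal{C}_g)\subseteq\mathcal{C}'_{f(g)}$, and isomorphisms of tensor functors $\beta_g:F\circ T_g\to T'_{f(g)}\circ F$ such that $$(\beta_g(Y)\otimes\mathrm{id}_{F(X)})\circ\eta(T_g(Y),X)\circ F(c(X,Y))=c'(F(X),F(Y))\circ\eta(X,Y)\qquad(X\in\mathcal{C}_g,\ Y\in\mathcal{C}),$$ $$T'_{f(g)}(\beta_h(X))\circ\beta_g(T_h(X))\circ F(\gamma_{g,h}(X))=\gamma'_{f(g),f(h)}(F(X))\circ\beta_{gh}(X)\qquad(X\in\mathcal{C}).$$ It is an equivalence if $f$ is an isomorphism and $F$ is an equivalence of categories; two crossed categories are equivalent if there is such an equivalence between them. **Proposition.** Let $(\omega,\gamma,\mu,c)$ and $(\omega',\gamma',\mu',c')$ be quasi-abelian $3$-cocycles on finite crossed modules $\mathcal{X}=(G,X,\partial)$ and $\mathcal{X}'=(G',X',\partial')$. Then $\mathcal{C}(\omega,\gamma,\mu,c)$ and $\mathcal{C}(\omega',\gamma',\mu',c')$ are equivalent as crossed categories if and only if there exists an isomorphism $(f,F):\mathcal{X}\to\mathcal{X}'$ of crossed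 modules such that $(\omega',\gamma',\mu',c')^{(f,F)}$ and $(\omega,\gamma,\mu,c)$ are cohomologous, i.e. define the same class in $H^3_{qa}(\mathcal{X},\mathbb{K}^\times)$. -/

import Mathlib

noncomputable section

universe u v w

set_option linter.unusedSectionVars false

open CategoryTheory MonoidalCategory
open scoped TensorProduct

/-! ## Crossed modules -/

/-- A crossed module `(G, X, ∂)`. -/
structure CrossedModule (G : Type v) (X : Type w) [Group G] [Group X] where
  act : G →* MulAut X
  bd : X →* G
  act_bd : ∀ x x' : X, act (bd x) x' = x * x' * x⁻¹
  bd_act : ∀ (g : G) (x : X), bd (act g x) = g * bd x * g⁻¹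

namespace CrossedModule

variable {G X G' X' : Type*} [Group G] [Group X] [Group G'] [Group X']

/-- A homomorphism `(f, F)` of crossed modules. -/
structure Hom (𝒳 : CrossedModule G X) (𝒴 : CrossedModule G' X') where
  f : G →* G'
  F : X →* X'
  bd_comm : ∀ x, 𝒴.bd (F x) = f (𝒳.bd x)
  act_comm : ∀ g x, F (𝒳.act g x) = 𝒴.act (f g) (F x)

/-- `(f, F)` is an isomorphism of crossed modules if `f` and `F` are isomorphisms. -/
def Hom.IsIso {𝒳 : CrossedModule G X} {𝒴 : CrossedModule G' X'} (φ : Hom 𝒳 𝒴) : Prop :=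
  Function.Bijective φ.f ∧ Function.Bijective φ.F

end CrossedModule

/-! ## Quasi-abelian third cohomology of a crossed module -/

/-- `ω` is a 3-cocycle on `X` with values in the trivial module `Kˣ`. -/
def IsThreeCocycle {K : Type u} [Field K] {X : Type w} [Group X] (ω : X → X → X → Kˣ) : Prop :=
  ∀ w x y z : X, ω x y z * ω w (x * y) z * ω w x y = ω w x (y * z) * ω (w * x) y z

/-- Quadruples `(ω, γ, μ, c)` of cochains; `γ g h x` stands for `γ_{g,h}(x)` and
`μ g x y` for `μ_g(x,y)`. They form an abelian group under pointwise multiplication. -/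
abbrev QACochain (K : Type u) [Field K] (G : Type v) (X : Type w) :=
  (X → X → X → Kˣ) × (G → G → X → Kˣ) × (G → X → X → Kˣ) × (X → X → Kˣ)

/-- The axioms of a quasi-abelian 3-cocycle on the crossed module `𝒳`. -/
structure IsQACocycle {K : Type u} [Field K] {G : Type v} {X : Type w} [Group G] [Group X]
    (𝒳 : CrossedModule G X) (ω : X → X → X → Kˣ) (γ : G → G → X → Kˣ) (μ : G → X → X → Kˣ)
    (c : X → X → Kˣ) : Prop where
  /-- `ω ∈ Z³(X, Kˣ)` -/
  cocycle_omega : IsThreeCocycle ω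
  /-- `γ ∈ Z²(G, C¹(X, Kˣ))`, for the right action `(φ ^ k)(x) = φ(ᵏx)` of `G` on cochains -/
  cocycle_gamma : ∀ g h k x, γ h k x * γ g (h * k) x = γ g h (𝒳.act k x) * γ (g * h) k x
  d_mu : ∀ g x y z, (μ g y z * μ g x (y * z)) / (μ g (x * y) z * μ g x y) =
    ω (𝒳.act g x) (𝒳.act g y) (𝒳.act g z) / ω x y z
  d_gamma : ∀ g h x y, (γ g h x * γ g h y) / γ g h (x * y) =
    (μ g (𝒳.act h x) (𝒳.act h y) * μ h x y) / μ (g * h) x y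
  c_act : ∀ g x y, c (𝒳.act g x) (𝒳.act g y) / c x y =
    μ g (x * y * x⁻¹) x / μ g x y * (γ (g * 𝒳.bd x * g⁻¹) g y / γ g (𝒳.bd x) y)
  c_mul_left : ∀ x y z, c (x * y) z =
    (ω x y z * ω ((x * y) * z * (x * y)⁻¹) x y) /
      (ω x (y * z * y⁻¹) y * γ (𝒳.bd x) (𝒳.bd y) z) * (c x (y * z * y⁻¹) * c y z)
  c_mul_right : ∀ x y z, c x (y * z) =
    ω (x * y * x⁻¹) x z / (ω x y z * ω (x * y * x⁻¹) (x * z * x⁻¹) x * μ (𝒳.bd x) y z) *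
      (c x y * c x z)

section Cohomology

variable (K : Type u) [Field K] {G : Type v} {X : Type w} [Group G] [Group X]
variable (𝒳 : CrossedModule G X)

/-- The group `Z³_qa(𝒳, Kˣ)` of quasi-abelian 3-cocycles, under pointwise multiplication. -/
def Z3qa : Subgroup (QACochain K G X) where
  carrier := {ξ | IsQACocycle 𝒳 ξ.1 ξ.2.1 ξ.2.2.1 ξ.2.2.2}
  one_mem' := by constructor <;> simp [IsThreeCocycle]
  mul_mem' := by
    rintro ⟨ω, γ, μ, c⟩ ⟨ω', γ', μ', c'⟩ h h'
    constructor
    · intro w x y z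
      have := congrArg₂ (· * ·) (h.cocycle_omega w x y z) (h'.cocycle_omega w x y z)
      simp only [Prod.fst_mul, Pi.mul_apply] at this ⊢
      exact (by ac_rfl : _ = _).trans (this.trans (by ac_rfl))
    · intro a b k x
      have := congrArg₂ (· * ·) (h.cocycle_gamma a b k x) (h'.cocycle_gamma a b k x)
      simp only [Prod.fst_mul, Prod.snd_mul, Pi.mul_apply] at this ⊢
      exact (by ac_rfl : _ = _).trans (this.trans (by ac_rfl))
    · intro g x y z
      have := congrArg₂ (· * ·) (h.d_mu g x y z) (h'.d_mu g x y z)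
      simp only [Prod.fst_mul, Prod.snd_mul, Pi.mul_apply, div_eq_mul_inv, mul_inv] at this ⊢
      exact (by ac_rfl : _ = _).trans (this.trans (by ac_rfl))
    · intro a b x y
      have := congrArg₂ (· * ·) (h.d_gamma a b x y) (h'.d_gamma a b x y)
      simp only [Prod.fst_mul, Prod.snd_mul, Pi.mul_apply, div_eq_mul_inv, mul_inv] at this ⊢
      exact (by ac_rfl : _ = _).trans (this.trans (by ac_rfl))
    · intro g x y
      have := congrArg₂ (· * ·) (h.c_act g x y) (h'.c_act g x y)
      simp only [Prod.fst_mul, Prod.snd_mul, Pi.mul_apply, div_eq_mul_inv, mul_inv] at this ⊢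
      exact (by ac_rfl : _ = _).trans (this.trans (by ac_rfl))
    · intro x y z
      have := congrArg₂ (· * ·) (h.c_mul_left x y z) (h'.c_mul_left x y z)
      simp only [Prod.fst_mul, Prod.snd_mul, Pi.mul_apply, div_eq_mul_inv, mul_inv] at this ⊢
      exact (by ac_rfl : _ = _).trans (this.trans (by ac_rfl))
    · intro x y z
      have := congrArg₂ (· * ·) (h.c_mul_right x y z) (h'.c_mul_right x y z)
      simp only [Prod.fst_mul, Prod.snd_mul, Pi.mul_apply, div_eq_mul_inv, mul_inv] at this ⊢
      exact (by ac_rfl : _ = _).trans (this.trans (by ac_rfl))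
  inv_mem' := by
    rintro ⟨ω, γ, μ, c⟩ h
    constructor
    · intro w x y z
      simpa [mul_comm, mul_left_comm, mul_assoc] using congrArg (·⁻¹) (h.cocycle_omega w x y z)
    · intro a b k x
      simpa [mul_comm, mul_left_comm, mul_assoc] using congrArg (·⁻¹) (h.cocycle_gamma a b k x)
    · intro g x y z
      have := congrArg (·⁻¹) (h.d_mu g x y z)
      simp only [Prod.fst_inv, Prod.snd_inv, Pi.inv_apply, div_eq_mul_inv, mul_inv] at this ⊢
      exact this
    · intro a b x y
      have := congrArg (·⁻¹) (h.d_gamma a b x y)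
      simp only [Prod.fst_inv, Prod.snd_inv, Pi.inv_apply, div_eq_mul_inv, mul_inv] at this ⊢
      exact this
    · intro g x y
      have := congrArg (·⁻¹) (h.c_act g x y)
      simp only [Prod.fst_inv, Prod.snd_inv, Pi.inv_apply, div_eq_mul_inv, mul_inv] at this ⊢
      exact this
    · intro x y z
      have := congrArg (·⁻¹) (h.c_mul_left x y z)
      simp only [Prod.fst_inv, Prod.snd_inv, Pi.inv_apply, div_eq_mul_inv, mul_inv] at this ⊢
      exact this
    · intro x y z
      have := congrArg (·⁻¹) (h.c_mul_right x y z)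
      simp only [Prod.fst_inv, Prod.snd_inv, Pi.inv_apply, div_eq_mul_inv, mul_inv] at this ⊢
      exact this

/-- The coboundary of a pair `(η, β)` with `η ∈ C²(X, Kˣ)` and `β ∈ C¹(G, C¹(X, Kˣ))`:
`(dη, dβ, g ↦ d(β_g) η^g / η, (x, y) ↦ β_{∂(x)}(y) η(xyx⁻¹, x) / η(x, y))`. -/
def qaCoboundary : (X → X → Kˣ) × (G → X → Kˣ) →* QACochain K G X where
  toFun p :=
    (fun x y z => (p.1 y z * p.1 x (y * z)) / (p.1 (x * y) z * p.1 x y),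
     fun g h x => (p.2 g (𝒳.act h x) * p.2 h x) / p.2 (g * h) x,
     fun g x y => (p.2 g x * p.2 g y) / p.2 g (x * y) *
       (p.1 (𝒳.act g x) (𝒳.act g y) / p.1 x y),
     fun x y => p.2 (𝒳.bd x) y * (p.1 (x * y * x⁻¹) x / p.1 x y))
  map_one' := by ext <;> simp
  map_mul' p q := by
    refine Prod.ext ?_ (Prod.ext ?_ (Prod.ext ?_ ?_)) <;> funext <;>
      simp only [Prod.fst_mul, Prod.snd_mul, Pi.mul_apply, div_eq_mul_inv, mul_inv] <;> ac_rfl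

/-- The group `B³_qa(𝒳, Kˣ)` of quasi-abelian 3-coboundaries. -/
def B3qa : Subgroup (QACochain K G X) := (qaCoboundary K 𝒳).range

theorem B3qa_le_Z3qa : B3qa K 𝒳 ≤ Z3qa K 𝒳 := by
  rintro _ ⟨⟨η, β⟩, rfl⟩
  constructor
  · intro w x y z
    apply Additive.ofMul.injective
    simp only [qaCoboundary, MonoidHom.coe_mk, OneHom.coe_mk, ofMul_mul, ofMul_div, mul_assoc]
    abel
  all_goals
    intros
    apply Additive.ofMul.injective
    simp only [qaCoboundary, MonoidHom.coe_mk, OneHom.coe_mk, ofMul_mul, ofMul_div, map_mul,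
      map_inv, MulAut.mul_apply, 𝒳.act_bd, 𝒳.bd_act, mul_inv_rev, mul_assoc,
      inv_mul_cancel_left, inv_mul_cancel, mul_one]
    abel

/-- The quasi-abelian third cohomology `H³_qa(𝒳, Kˣ) = Z³_qa(𝒳, Kˣ) / B³_qa(𝒳, Kˣ)`. -/
abbrev H3qa : Type _ := Z3qa K 𝒳 ⧸ (B3qa K 𝒳).subgroupOf (Z3qa K 𝒳)

variable {G' : Type*} {X' : Type*} [Group G'] [Group X'] {𝒳} {𝒳' : CrossedModule G' X'}

/-- The pullback `ξ ↦ ξ^{(f, F)}` of quasi-abelian 3-cocycles along a homomorphism `(f, F)`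
of crossed modules. -/
def pullback (φ : CrossedModule.Hom 𝒳 𝒳') : Z3qa K 𝒳' →* Z3qa K 𝒳 where
  toFun ξ :=
    ⟨(fun x y z => ξ.1.1 (φ.F x) (φ.F y) (φ.F z),
      fun g h x => ξ.1.2.1 (φ.f g) (φ.f h) (φ.F x),
      fun g x y => ξ.1.2.2.1 (φ.f g) (φ.F x) (φ.F y),
      fun x y => ξ.1.2.2.2 (φ.F x) (φ.F y)), by
      obtain ⟨⟨ω, γ, μ, c⟩, h⟩ := ξ
      constructor
      · intro w x y z
        simpa using h.cocycle_omega (φ.F w) (φ.F x) (φ.F y) (φ.F z)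
      · intro a b k x
        simpa [φ.act_comm] using h.cocycle_gamma (φ.f a) (φ.f b) (φ.f k) (φ.F x)
      · intro g x y z
        simpa [φ.act_comm] using h.d_mu (φ.f g) (φ.F x) (φ.F y) (φ.F z)
      · intro a b x y
        simpa [φ.act_comm] using h.d_gamma (φ.f a) (φ.f b) (φ.F x) (φ.F y)
      · intro g x y
        simpa [φ.act_comm, φ.bd_comm] using h.c_act (φ.f g) (φ.F x) (φ.F y)
      · intro x y z
        simpa [φ.act_comm, φ.bd_comm] using h.c_mul_left (φ.F x) (φ.F y) (φ.F z)
      · intro x y z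
        simpa [φ.act_comm, φ.bd_comm] using h.c_mul_right (φ.F x) (φ.F y) (φ.F z)⟩
  map_one' := rfl
  map_mul' _ _ := rfl

end Cohomology

/-! ## The pointed category `Vec_X^ω` -/

/-- The type of 3-cocycles on `X` with values in `Kˣ`. -/
abbrev Cocycle3 (K : Type u) [Field K] (X : Type w) [Group X] : Type (max u w) :=
  {ω : X → X → X → Kˣ // IsThreeCocycle ω}

/-- Objects of `Vec_X^ω`: finite-dimensional `X`-graded vector spaces `V`. The grading
`V = ⨁ V_x` is recorded by its projections `proj x : V → V` onto `V_x`, so that `V_x` is the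
range of `proj x`. The cocycle `ω` enters only in the monoidal structure below. -/
structure VecTw {K : Type u} [Field K] {X : Type w} [Group X] [Fintype X]
    (ω : Cocycle3 K X) where
  carrier : Type u
  [addCommGroup : AddCommGroup carrier]
  [module : Module K carrier]
  [finite : Module.Finite K carrier]
  proj : X → Module.End K carrier
  isProj : CompleteOrthogonalIdempotents proj

namespace VecTw

attribute [instance] VecTw.addCommGroup VecTw.module VecTw.finite

variable {K : Type u} [Field K] {X : Type w} [Group X] [Fintype X] {ω : Cocycle3 K X}

instance : CoeSort (VecTw ω) (Type u) := ⟨VecTw.carrier⟩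

theorem proj_proj_self (V : VecTw ω) (x : X) (v : V) : V.proj x (V.proj x v) = V.proj x v :=
  LinearMap.congr_fun (V.isProj.idem x) v

theorem proj_proj_ne (V : VecTw ω) {x y : X} (h : x ≠ y) (v : V) :
    V.proj x (V.proj y v) = 0 :=
  LinearMap.congr_fun (V.isProj.ortho h) v

theorem sum_proj (V : VecTw ω) (v : V) : ∑ x, V.proj x v = v := by
  simpa using LinearMap.congr_fun V.isProj.complete v

/-- `v` is homogeneous of degree `x`, i.e. `v ∈ V_x`. -/
def IsDeg (V : VecTw ω) (x : X) (v : V) : Prop := V.proj x v = v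

theorem isDeg_proj (V : VecTw ω) (x : X) (v : V) : V.IsDeg x (V.proj x v) :=
  V.proj_proj_self x v

theorem IsDeg.smul {V : VecTw ω} {x : X} {v : V} (h : V.IsDeg x v) (a : K) :
    V.IsDeg x (a • v) := by
  unfold IsDeg at *; rw [map_smul, h]

theorem IsDeg.proj_ne {V : VecTw ω} {x y : X} {v : V} (h : V.IsDeg x v) (hne : y ≠ x) :
    V.proj y v = 0 := by
  rw [← h]; exact V.proj_proj_ne hne v

/-- The homogeneous components form an internal direct sum decomposition. -/
theorem isInternal (V : VecTw ω) [DecidableEq X] :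
    DirectSum.IsInternal fun x => LinearMap.range (V.proj x) := by
  let D : V →+ DirectSum X fun x => LinearMap.range (V.proj x) :=
    ∑ x, (DirectSum.of (fun x => LinearMap.range (V.proj x)) x).comp
      (V.proj x).rangeRestrict.toAddMonoidHom
  have hD : ∀ v, D v = ∑ x, DirectSum.of (fun x => LinearMap.range (V.proj x)) x
      ⟨V.proj x v, v, rfl⟩ := fun v => by
    simp only [D, AddMonoidHom.finsetSum_apply]; rfl
  let _ := DirectSum.Decomposition.ofAddHom (fun x => LinearMap.range (V.proj x)) D
    (by
      ext v
      simp only [AddMonoidHom.comp_apply, hD, map_sum, DirectSum.coeAddMonoidHom_of,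
        AddMonoidHom.id_apply]
      exact V.sum_proj v)
    (by
      refine DirectSum.addHom_ext fun x v => ?_
      obtain ⟨_, v, rfl⟩ := v
      simp only [AddMonoidHom.comp_apply, hD, DirectSum.coeAddMonoidHom_of,
        AddMonoidHom.id_apply]
      rw [Finset.sum_eq_single x]
      · congr 1; exact Subtype.ext (V.proj_proj_self x v)
      · intro y _ hy
        rw [show (⟨V.proj y (V.proj x v), _, rfl⟩ : LinearMap.range (V.proj y)) = 0 from
          Subtype.ext (V.proj_proj_ne hy v), map_zero]
      · simp)
  exact DirectSum.Decomposition.isInternal _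

/-- Linear maps agreeing on homogeneous elements are equal. -/
theorem lin_ext {V : VecTw ω} {M : Type*} [AddCommGroup M] [Module K M] {f g : V →ₗ[K] M}
    (h : ∀ x v, V.IsDeg x v → f v = g v) : f = g := by
  ext v
  rw [← V.sum_proj v, map_sum, map_sum]
  exact Finset.sum_congr rfl fun x _ => h x _ (V.isDeg_proj x v)

/-- Projections are determined by their values on homogeneous elements. -/
theorem sum_eq_of_isDeg {V : VecTw ω} {M : Type*} [AddCommGroup M] {x : X} {v : V}
    (h : V.IsDeg x v) (F : X → V → M) (hF : ∀ y, F y 0 = 0) :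
    ∑ y, F y (V.proj y v) = F x v := by
  rw [Finset.sum_eq_single x]
  · rw [h]
  · intro y _ hy; rw [h.proj_ne hy, hF]
  · simp

/-- Morphisms: linear maps preserving the grading. -/
@[ext]
structure Hom (V W : VecTw ω) where
  lin : V →ₗ[K] W
  comm : ∀ x v, W.proj x (lin v) = lin (V.proj x v)

@[simps]
instance : Category (VecTw ω) where
  Hom := Hom
  id V := ⟨LinearMap.id, fun _ _ => rfl⟩
  comp f g := ⟨g.lin ∘ₗ f.lin, fun x v => by simp [f.comm, g.comm]⟩

variable {U V W Z : VecTw ω}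

/-- The linear map underlying a morphism. -/
abbrev lin (f : V ⟶ W) : V →ₗ[K] W := Hom.lin f

theorem hom_ext {f g : V ⟶ W} (h : ∀ x v, V.IsDeg x v → lin f v = lin g v) : f = g :=
  Hom.ext (lin_ext h)

theorem proj_lin (f : V ⟶ W) (x : X) (v : V) : W.proj x (lin f v) = lin f (V.proj x v) :=
  Hom.comm f x v

theorem IsDeg.lin (f : V ⟶ W) {x : X} {v : V} (h : V.IsDeg x v) : W.IsDeg x (lin f v) := by
  unfold IsDeg at *; rw [proj_lin, h]

@[simp] theorem lin_id (v : V) : lin (𝟙 V) v = v := rfl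
@[simp] theorem lin_comp (f : U ⟶ V) (g : V ⟶ W) (v : U) : lin (f ≫ g) v = lin g (lin f v) := rfl

/-- A linear map sending `V_x` to `W_x` for all `x` is a morphism. -/
def mkHom (f : V →ₗ[K] W) (h : ∀ x v, V.IsDeg x v → W.IsDeg x (f v)) : V ⟶ W where
  lin := f
  comm x v := by
    have : W.proj x ∘ₗ f = f ∘ₗ V.proj x := by
      refine lin_ext fun y v hv => ?_
      by_cases e : x = y
      · subst e
        simp only [LinearMap.comp_apply]
        rw [h x v hv, hv]
      · simp only [LinearMap.comp_apply]
        rw [(h y v hv).proj_ne e, hv.proj_ne e, map_zero]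
    exact LinearMap.congr_fun this v

@[simp] theorem lin_mkHom (f : V →ₗ[K] W) (h) (v : V) : lin (mkHom f h) v = f v := rfl

/-! ### Linear structure -/

instance : Add (V ⟶ W) := ⟨fun f g => ⟨lin f + lin g, fun x v => by simp [proj_lin]⟩⟩
instance : Zero (V ⟶ W) := ⟨⟨0, fun x v => by simp⟩⟩
instance : Neg (V ⟶ W) := ⟨fun f => ⟨-lin f, fun x v => by simp [proj_lin]⟩⟩
instance : Sub (V ⟶ W) := ⟨fun f g => ⟨lin f - lin g, fun x v => by simp [proj_lin]⟩⟩
instance : SMul ℕ (V ⟶ W) := ⟨fun n f => ⟨n • lin f, fun x v => by simp [proj_lin]⟩⟩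
instance : SMul ℤ (V ⟶ W) := ⟨fun n f => ⟨n • lin f, fun x v => by simp [proj_lin]⟩⟩
instance : SMul K (V ⟶ W) := ⟨fun a f => ⟨a • lin f, fun x v => by simp [proj_lin]⟩⟩

theorem lin_injective : Function.Injective (lin : (V ⟶ W) → (V →ₗ[K] W)) :=
  fun _ _ h => Hom.ext h

instance : AddCommGroup (V ⟶ W) :=
  lin_injective.addCommGroup _ rfl (fun _ _ => rfl) (fun _ => rfl) (fun _ _ => rfl)
    (fun _ _ => rfl) (fun _ _ => rfl)

/-- `lin` as an additive map. -/
def linAddHom : (V ⟶ W) →+ (V →ₗ[K] W) where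
  toFun := lin
  map_zero' := rfl
  map_add' _ _ := rfl

instance : Module K (V ⟶ W) :=
  lin_injective.module K (linAddHom (V := V) (W := W)) (fun _ _ => rfl)

@[simp] theorem lin_add (f g : V ⟶ W) (v : V) : lin (f + g) v = lin f v + lin g v := rfl
@[simp] theorem lin_zero (v : V) : lin (0 : V ⟶ W) v = 0 := rfl
@[simp] theorem lin_smul (a : K) (f : V ⟶ W) (v : V) : lin (a • f) v = a • lin f v := rfl

theorem lin_sum {ι : Type*} (s : Finset ι) (f : ι → (V ⟶ W)) (v : V) :
    lin (∑ i ∈ s, f i) v = ∑ i ∈ s, lin (f i) v := by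
  have h := map_sum (linAddHom (V := V) (W := W)) f s
  have h2 := LinearMap.congr_fun h v
  rw [LinearMap.sum_apply] at h2
  exact h2

instance : Preadditive (VecTw ω) where
  add_comp _ _ _ _ _ _ := hom_ext fun _ _ _ => by simp
  comp_add _ _ _ _ _ _ := hom_ext fun _ _ _ => by simp

instance : Linear K (VecTw ω) where
  smul_comp _ _ _ _ _ _ := hom_ext fun _ _ _ => by simp
  comp_smul _ _ _ _ _ _ := hom_ext fun _ _ _ => by simp

/-- An isomorphism from two mutually inverse grading-preserving linear maps. -/
def mkIso (f : V ⟶ W) (g : W ⟶ V) (h₁ : ∀ x v, V.IsDeg x v → lin g (lin f v) = v)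
    (h₂ : ∀ x w, W.IsDeg x w → lin f (lin g w) = w) : V ≅ W where
  hom := f
  inv := g
  hom_inv_id := hom_ext fun x v hv => by simpa using h₁ x v hv
  inv_hom_id := hom_ext fun x v hv => by simpa using h₂ x v hv

/-! ### Tensor product -/

/-- The tensor product of two graded spaces: `(V ⊗ W)_z = ⨁_{xy = z} V_x ⊗ W_y`. -/
abbrev tensor (V W : VecTw ω) : VecTw ω where
  carrier := V ⊗[K] W
  proj z := ∑ x, TensorProduct.map (V.proj x) (W.proj (x⁻¹ * z))
  isProj := by
    classical
    rw [CompleteOrthogonalIdempotents.iff_ortho_complete]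
    constructor
    · intro z z' hz
      simp only [Finset.sum_mul_sum, Module.End.mul_eq_comp, ← TensorProduct.map_comp]
      refine Finset.sum_eq_zero fun x _ => Finset.sum_eq_zero fun y _ => ?_
      by_cases e : x = y
      · subst e
        have : W.proj (x⁻¹ * z) ∘ₗ W.proj (x⁻¹ * z') = 0 :=
          W.isProj.ortho (fun h => hz (mul_left_cancel h))
        rw [this, TensorProduct.map_zero_right]
      · have : V.proj x ∘ₗ V.proj y = 0 := V.isProj.ortho e
        rw [this, TensorProduct.map_zero_left]
    · rw [Finset.sum_comm]
      have : ∀ x : X, ∑ z, TensorProduct.map (V.proj x) (W.proj (x⁻¹ * z)) =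
          TensorProduct.map (V.proj x) (∑ z, W.proj z) := by
        intro x
        rw [← Equiv.sum_comp (Equiv.mulLeft x⁻¹) W.proj]
        simp only [← TensorProduct.mapBilinear_apply, map_sum]
        rfl
      simp only [this, W.isProj.complete]
      have h2 := V.isProj.complete
      calc ∑ x, TensorProduct.map (V.proj x) 1 = TensorProduct.map (∑ x, V.proj x) 1 := by
            simp only [← TensorProduct.mapBilinear_apply, map_sum, LinearMap.sum_apply]
        _ = 1 := by rw [h2]; exact TensorProduct.map_id

open Classical in
/-- The unit object: the field `K` in degree `1`. -/
abbrev one (ω : Cocycle3 K X) : VecTw ω where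
  carrier := K
  proj x := if x = 1 then 1 else 0
  isProj := by
    rw [CompleteOrthogonalIdempotents.iff_ortho_complete]
    constructor
    · intro x y h
      by_cases e : x = 1
      · simp [e]; rintro rfl; exact absurd e h
      · simp [e]
    · simp

theorem isDeg_tmul {x y : X} {v : V} {w : W} (hv : V.IsDeg x v) (hw : W.IsDeg y w) :
    (tensor V W).IsDeg (x * y) (v ⊗ₜ[K] w) := by
  change (∑ a, TensorProduct.map (V.proj a) (W.proj (a⁻¹ * (x * y)))) (v ⊗ₜ[K] w) = _
  simp only [LinearMap.sum_apply, TensorProduct.map_tmul]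
  rw [sum_eq_of_isDeg hv (fun a v' => v' ⊗ₜ[K] W.proj (a⁻¹ * (x * y)) w) (by simp)]
  rw [inv_mul_cancel_left, hw]

theorem isDeg_one (a : K) : (one ω).IsDeg 1 a := by
  classical
  change (if (1 : X) = 1 then (1 : Module.End K K) else 0) a = a
  rw [if_pos rfl]; rfl

theorem isDeg_one_ne {x : X} (h : x ≠ 1) {a : K} (ha : (one ω).IsDeg x a) : a = 0 := by
  classical
  change (if x = 1 then (1 : Module.End K K) else 0) a = a at ha
  rw [if_neg h] at ha; exact ha.symm

theorem ext₂ {M : Type*} [AddCommGroup M] [Module K M] {f g : V ⊗[K] W →ₗ[K] M}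
    (h : ∀ x v y w, V.IsDeg x v → W.IsDeg y w → f (v ⊗ₜ w) = g (v ⊗ₜ w)) : f = g := by
  refine TensorProduct.curry_injective (lin_ext fun x v hv => lin_ext fun y w hw => ?_)
  exact h x v y w hv hw

theorem ext₃ {M : Type*} [AddCommGroup M] [Module K M] {f g : (U ⊗[K] V) ⊗[K] W →ₗ[K] M}
    (h : ∀ x u y v z w, U.IsDeg x u → V.IsDeg y v → W.IsDeg z w →
      f ((u ⊗ₜ v) ⊗ₜ w) = g ((u ⊗ₜ v) ⊗ₜ w)) : f = g := by
  refine TensorProduct.curry_injective (ext₂ fun x u y v hu hv => lin_ext fun z w hw => ?_)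
  exact h x u y v z w hu hv hw

theorem ext₃' {M : Type*} [AddCommGroup M] [Module K M] {f g : U ⊗[K] (V ⊗[K] W) →ₗ[K] M}
    (h : ∀ x u y v z w, U.IsDeg x u → V.IsDeg y v → W.IsDeg z w →
      f (u ⊗ₜ (v ⊗ₜ w)) = g (u ⊗ₜ (v ⊗ₜ w))) : f = g := by
  refine TensorProduct.curry_injective (lin_ext fun x u hu => ext₂ fun y v z w hv hw => ?_)
  exact h x u y v z w hu hv hw

theorem ext₄ {M : Type*} [AddCommGroup M] [Module K M]
    {f g : ((U ⊗[K] V) ⊗[K] W) ⊗[K] Z →ₗ[K] M}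
    (h : ∀ x u y v z w t r, U.IsDeg x u → V.IsDeg y v → W.IsDeg z w → Z.IsDeg t r →
      f (((u ⊗ₜ v) ⊗ₜ w) ⊗ₜ r) = g (((u ⊗ₜ v) ⊗ₜ w) ⊗ₜ r)) : f = g := by
  refine TensorProduct.curry_injective
    (ext₃ fun x u y v z w hu hv hw => lin_ext fun t r hr => ?_)
  exact h x u y v z w t r hu hv hw hr

/-- A linear map on a tensor product preserving degrees of homogeneous tensors is a morphism. -/
def mkHom₂ (f : V ⊗[K] W →ₗ[K] Z)
    (h : ∀ x v y w, V.IsDeg x v → W.IsDeg y w → Z.IsDeg (x * y) (f (v ⊗ₜ w))) :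
    tensor V W ⟶ Z where
  lin := f
  comm z t := by
    have : Z.proj z ∘ₗ f = f ∘ₗ (tensor V W).proj z := by
      refine ext₂ (f := Z.proj z ∘ₗ f) (g := f ∘ₗ (tensor V W).proj z) fun x v y w hv hw => ?_
      have h1 := h x v y w hv hw
      have h2 := isDeg_tmul hv hw
      simp only [LinearMap.comp_apply]
      by_cases e : z = x * y
      · subst e; exact h1.trans (congrArg f h2.symm)
      · exact (h1.proj_ne e).trans ((congrArg f (h2.proj_ne e)).trans (map_zero f)).symm
    exact LinearMap.congr_fun this t

/-- The tensor product of two morphisms. -/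
def tensorMap {V V' W W' : VecTw ω} (f : V ⟶ V') (g : W ⟶ W') : tensor V W ⟶ tensor V' W' :=
  mkHom₂ (Z := tensor V' W') (TensorProduct.map (lin f) (lin g))
    fun _ _ _ _ hv hw => isDeg_tmul (hv.lin f) (hw.lin g)

/-- Multiplication by the scalar `φ x` on `V_x`. -/
def scal₁ (φ : X → Kˣ) (V : VecTw ω) : V →ₗ[K] V := ∑ x, (φ x : K) • V.proj x

theorem scal₁_apply (φ : X → Kˣ) {x : X} {v : V} (hv : V.IsDeg x v) :
    scal₁ φ V v = (φ x : K) • v := by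
  simp only [scal₁, LinearMap.sum_apply, LinearMap.smul_apply]
  exact sum_eq_of_isDeg hv (fun x v => (φ x : K) • v) (by simp)

/-- Multiplication by the scalar `φ x y` on `V_x ⊗ W_y`. -/
def scal₂ (φ : X → X → Kˣ) (V W : VecTw ω) : V ⊗[K] W →ₗ[K] V ⊗[K] W :=
  ∑ x, ∑ y, (φ x y : K) • TensorProduct.map (V.proj x) (W.proj y)

theorem scal₂_apply (φ : X → X → Kˣ) {x y : X} {v : V} {w : W} (hv : V.IsDeg x v)
    (hw : W.IsDeg y w) : scal₂ φ V W (v ⊗ₜ w) = (φ x y : K) • (v ⊗ₜ[K] w) := by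
  simp only [scal₂, LinearMap.sum_apply, LinearMap.smul_apply, TensorProduct.map_tmul]
  rw [sum_eq_of_isDeg hv (fun a v => ∑ b, (φ a b : K) • (v ⊗ₜ[K] W.proj b w)) (by simp)]
  exact sum_eq_of_isDeg hw (fun b w => (φ x b : K) • (v ⊗ₜ[K] w)) (by simp)

/-- Multiplication by the scalar `φ x y z` on `U_x ⊗ (V_y ⊗ W_z)`. -/
def scal₃ (φ : X → X → X → Kˣ) (U V W : VecTw ω) :
    U ⊗[K] (V ⊗[K] W) →ₗ[K] U ⊗[K] (V ⊗[K] W) :=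
  ∑ x, ∑ y, ∑ z, (φ x y z : K) •
    TensorProduct.map (U.proj x) (TensorProduct.map (V.proj y) (W.proj z))

theorem scal₃_apply (φ : X → X → X → Kˣ) {x y z : X} {u : U} {v : V} {w : W}
    (hu : U.IsDeg x u) (hv : V.IsDeg y v) (hw : W.IsDeg z w) :
    scal₃ φ U V W (u ⊗ₜ (v ⊗ₜ w)) = (φ x y z : K) • (u ⊗ₜ[K] (v ⊗ₜ[K] w)) := by
  simp only [scal₃, LinearMap.sum_apply, LinearMap.smul_apply, TensorProduct.map_tmul]
  rw [sum_eq_of_isDeg hu (fun a u => ∑ b, ∑ d, (φ a b d : K) •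
    (u ⊗ₜ[K] (V.proj b v ⊗ₜ[K] W.proj d w))) (by simp)]
  rw [sum_eq_of_isDeg hv (fun b v => ∑ d, (φ x b d : K) •
    (u ⊗ₜ[K] (v ⊗ₜ[K] W.proj d w))) (by simp)]
  exact sum_eq_of_isDeg hw (fun d w => (φ x y d : K) • (u ⊗ₜ[K] (v ⊗ₜ[K] w))) (by simp)

theorem isDeg_tmul₃ {x y z : X} {u : U} {v : V} {w : W} (hu : U.IsDeg x u) (hv : V.IsDeg y v)
    (hw : W.IsDeg z w) : (tensor U (tensor V W)).IsDeg (x * y * z) (u ⊗ₜ[K] (v ⊗ₜ[K] w)) := by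
  rw [mul_assoc]; exact isDeg_tmul hu (isDeg_tmul (V := V) (W := W) hv hw)

/-- The associator `(u ⊗ v) ⊗ w ↦ ω(x,y,z) u ⊗ (v ⊗ w)` as a linear map. -/
def assocLin (U V W : VecTw ω) : (U ⊗[K] V) ⊗[K] W →ₗ[K] U ⊗[K] (V ⊗[K] W) :=
  scal₃ ω.1 U V W ∘ₗ (TensorProduct.assoc K U V W).toLinearMap

theorem assocLin_apply {x y z : X} {u : U} {v : V} {w : W}
    (hu : U.IsDeg x u) (hv : V.IsDeg y v) (hw : W.IsDeg z w) :
    assocLin U V W ((u ⊗ₜ v) ⊗ₜ w) = (ω.1 x y z : K) • (u ⊗ₜ[K] (v ⊗ₜ[K] w)) :=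
  scal₃_apply ω.1 hu hv hw

/-- The inverse associator as a linear map. -/
def assocInvLin (U V W : VecTw ω) : U ⊗[K] (V ⊗[K] W) →ₗ[K] (U ⊗[K] V) ⊗[K] W :=
  (TensorProduct.assoc K U V W).symm.toLinearMap ∘ₗ scal₃ (fun x y z => (ω.1 x y z)⁻¹) U V W

theorem assocInvLin_apply {x y z : X} {u : U} {v : V} {w : W}
    (hu : U.IsDeg x u) (hv : V.IsDeg y v) (hw : W.IsDeg z w) :
    assocInvLin U V W (u ⊗ₜ (v ⊗ₜ w)) = ((ω.1 x y z)⁻¹ : K) • ((u ⊗ₜ[K] v) ⊗ₜ[K] w) := by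
  simp only [assocInvLin, LinearMap.comp_apply]
  rw [scal₃_apply _ hu hv hw, map_smul]
  simp

theorem comm_at {f : V →ₗ[K] W} {x : X} {v : V} (hv : V.IsDeg x v) (hf : W.IsDeg x (f v))
    (z : X) : W.proj z (f v) = f (V.proj z v) := by
  by_cases e : z = x
  · subst e; exact hf.trans (congrArg f hv.symm)
  · exact (hf.proj_ne e).trans ((congrArg f (hv.proj_ne e)).trans (map_zero f)).symm

/-- The associator `(u ⊗ v) ⊗ w ↦ ω(x,y,z) u ⊗ (v ⊗ w)`. -/
def assoc (U V W : VecTw ω) : tensor (tensor U V) W ≅ tensor U (tensor V W) where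
  hom := ⟨assocLin U V W, fun t v => LinearMap.congr_fun
    (f := (tensor U (tensor V W)).proj t ∘ₗ assocLin U V W)
    (g := assocLin U V W ∘ₗ (tensor (tensor U V) W).proj t)
    (ext₃ fun x u y v z w hu hv hw => by
      refine comm_at (V := tensor (tensor U V) W) (W := tensor U (tensor V W))
        (isDeg_tmul (V := tensor U V) (isDeg_tmul hu hv) hw) ?_ t
      rw [assocLin_apply hu hv hw]
      exact (isDeg_tmul₃ hu hv hw).smul _) v⟩
  inv := ⟨assocInvLin U V W, fun t v => LinearMap.congr_fun
    (f := (tensor (tensor U V) W).proj t ∘ₗ assocInvLin U V W)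
    (g := assocInvLin U V W ∘ₗ (tensor U (tensor V W)).proj t)
    (ext₃' fun x u y v z w hu hv hw => by
      refine comm_at (V := tensor U (tensor V W)) (W := tensor (tensor U V) W)
        (isDeg_tmul₃ hu hv hw) ?_ t
      rw [assocInvLin_apply hu hv hw]
      exact (isDeg_tmul (V := tensor U V) (isDeg_tmul hu hv) hw).smul _) v⟩
  hom_inv_id := Hom.ext (ext₃ fun x u y v z w hu hv hw => by
    change assocInvLin U V W (assocLin U V W _) = _
    rw [assocLin_apply hu hv hw, map_smul, assocInvLin_apply hu hv hw, smul_smul]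
    simp)
  inv_hom_id := Hom.ext (ext₃' fun x u y v z w hu hv hw => by
    change assocLin U V W (assocInvLin U V W _) = _
    rw [assocInvLin_apply hu hv hw, map_smul, assocLin_apply hu hv hw, smul_smul]
    simp)

/-- The left unit constraint `1 ⊗ v ↦ ω(1,1,x)⁻¹ v`. -/
def leftUnit (V : VecTw ω) : tensor (one ω) V ≅ V where
  hom := mkHom₂ (V := one ω)
    (scal₁ (fun x => (ω.1 1 1 x)⁻¹) V ∘ₗ (TensorProduct.lid K V).toLinearMap)
    fun x a y v ha hv => by
      by_cases e : x = 1
      · subst e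
        rw [one_mul]
        have h := (hv.smul a)
        simp only [LinearMap.comp_apply, LinearEquiv.coe_coe, TensorProduct.lid_tmul]
        rw [scal₁_apply _ h]
        exact h.smul _
      · rw [isDeg_one_ne e ha]; simp [IsDeg]
  inv := mkHom (W := tensor (one ω) V)
    ((TensorProduct.lid K V).symm.toLinearMap ∘ₗ scal₁ (fun x => ω.1 1 1 x) V)
    fun x v hv => by
      simp only [LinearMap.comp_apply]
      rw [scal₁_apply _ hv, map_smul]
      have := isDeg_tmul (isDeg_one (ω := ω) 1) hv
      rw [one_mul] at this
      exact this.smul _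
  hom_inv_id := Hom.ext (ext₂ (V := one ω) fun x a y v ha hv => by
    change (TensorProduct.lid K V).symm (scal₁ (fun x => ω.1 1 1 x) V
      (scal₁ (fun x => (ω.1 1 1 x)⁻¹) V (TensorProduct.lid K V (a ⊗ₜ v)))) = a ⊗ₜ v
    rw [LinearEquiv.symm_apply_eq, TensorProduct.lid_tmul, scal₁_apply _ (hv.smul a), map_smul,
      scal₁_apply _ (hv.smul a), smul_smul]
    simp)
  inv_hom_id := hom_ext fun x v hv => by
    change scal₁ (fun x => (ω.1 1 1 x)⁻¹) V (TensorProduct.lid K V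
      ((TensorProduct.lid K V).symm (scal₁ (fun x => ω.1 1 1 x) V v))) = v
    rw [LinearEquiv.apply_symm_apply, scal₁_apply _ hv, map_smul, scal₁_apply _ hv, smul_smul]
    simp

/-- The right unit constraint `v ⊗ 1 ↦ ω(x,1,1) v`. -/
def rightUnit (V : VecTw ω) : tensor V (one ω) ≅ V where
  hom := mkHom₂ (W := one ω)
    (scal₁ (fun x => ω.1 x 1 1) V ∘ₗ (TensorProduct.rid K V).toLinearMap)
    fun x v y a hv ha => by
      by_cases e : y = 1
      · subst e
        rw [mul_one]
        have h := (hv.smul a)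
        simp only [LinearMap.comp_apply, LinearEquiv.coe_coe, TensorProduct.rid_tmul]
        rw [scal₁_apply _ h]
        exact h.smul _
      · rw [isDeg_one_ne e ha]; simp [IsDeg]
  inv := mkHom (W := tensor V (one ω))
    ((TensorProduct.rid K V).symm.toLinearMap ∘ₗ scal₁ (fun x => (ω.1 x 1 1)⁻¹) V)
    fun x v hv => by
      simp only [LinearMap.comp_apply]
      rw [scal₁_apply _ hv, map_smul]
      have := isDeg_tmul hv (isDeg_one (ω := ω) 1)
      rw [mul_one] at this
      exact this.smul _
  hom_inv_id := Hom.ext (ext₂ (W := one ω) fun x v y a hv ha => by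
    change (TensorProduct.rid K V).symm (scal₁ (fun x => (ω.1 x 1 1)⁻¹) V
      (scal₁ (fun x => ω.1 x 1 1) V (TensorProduct.rid K V (v ⊗ₜ a)))) = v ⊗ₜ a
    rw [LinearEquiv.symm_apply_eq, TensorProduct.rid_tmul, scal₁_apply _ (hv.smul a), map_smul,
      scal₁_apply _ (hv.smul a), smul_smul]
    simp)
  inv_hom_id := hom_ext fun x v hv => by
    change scal₁ (fun x => ω.1 x 1 1) V (TensorProduct.rid K V
      ((TensorProduct.rid K V).symm (scal₁ (fun x => (ω.1 x 1 1)⁻¹) V v))) = v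
    rw [LinearEquiv.apply_symm_apply, scal₁_apply _ hv, map_smul, scal₁_apply _ hv, smul_smul]
    simp

theorem leftUnit_hom_apply {V : VecTw ω} {x : X} {v : V} (a : K) (hv : V.IsDeg x v) :
    lin (leftUnit V).hom (a ⊗ₜ[K] v) = ((ω.1 1 1 x)⁻¹ : K) • a • v := by
  change scal₁ (fun x => (ω.1 1 1 x)⁻¹) V (TensorProduct.lid K V (a ⊗ₜ v)) = _
  rw [TensorProduct.lid_tmul, scal₁_apply _ (hv.smul a)]
  simp

theorem rightUnit_hom_apply {V : VecTw ω} {x : X} {v : V} (a : K) (hv : V.IsDeg x v) :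
    lin (rightUnit V).hom (v ⊗ₜ[K] a) = (ω.1 x 1 1 : K) • a • v := by
  change scal₁ (fun x => ω.1 x 1 1) V (TensorProduct.rid K V (v ⊗ₜ a)) = _
  rw [TensorProduct.rid_tmul, scal₁_apply _ (hv.smul a)]

instance : MonoidalCategoryStruct (VecTw ω) where
  tensorObj := tensor
  tensorHom f g := tensorMap f g
  whiskerLeft V _ _ f := tensorMap (𝟙 V) f
  whiskerRight f W := tensorMap f (𝟙 W)
  tensorUnit := one ω
  associator := assoc
  leftUnitor := leftUnit
  rightUnitor := rightUnit

theorem cocycle_val (w x y z : X) : (ω.1 x y z : K) * ω.1 w (x * y) z * ω.1 w x y =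
    ω.1 w x (y * z) * ω.1 (w * x) y z := by
  exact_mod_cast congrArg Units.val (ω.2 w x y z)

theorem cocycle_one (x y : X) : (ω.1 x 1 y : K) = ω.1 1 1 y * ω.1 x 1 1 := by
  have h := cocycle_val (ω := ω) x 1 1 y
  simp only [mul_one, one_mul] at h
  have h2 := (ω.1 x 1 y).ne_zero
  exact mul_left_cancel₀ h2 (by linear_combination -h)

instance : MonoidalCategory (VecTw ω) := MonoidalCategory.ofTensorHom
  (id_tensorHom_id := fun V W => Hom.ext (TensorProduct.map_id))
  (id_tensorHom := fun _ _ _ _ => rfl)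
  (tensorHom_id := fun _ _ => rfl)
  (tensorHom_comp_tensorHom := fun f₁ f₂ g₁ g₂ =>
    Hom.ext (TensorProduct.map_comp _ _ _ _).symm)
  (associator_naturality := fun {U V W U' V' W'} f₁ f₂ f₃ => Hom.ext
    (ext₃ fun x u y v z w hu hv hw => by
      change assocLin U' V' W' ((lin f₁ u ⊗ₜ lin f₂ v) ⊗ₜ lin f₃ w) =
        TensorProduct.map (lin f₁) (TensorProduct.map (lin f₂) (lin f₃))
          (assocLin U V W ((u ⊗ₜ v) ⊗ₜ w))
      rw [assocLin_apply hu hv hw, assocLin_apply (hu.lin f₁) (hv.lin f₂) (hw.lin f₃), map_smul,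
        TensorProduct.map_tmul, TensorProduct.map_tmul]))
  (leftUnitor_naturality := fun {V W} f => Hom.ext (ext₂ (V := one ω) fun x a y v ha hv => by
    change lin (leftUnit W).hom (a ⊗ₜ[K] lin f v) = lin f (lin (leftUnit V).hom (a ⊗ₜ[K] v))
    rw [leftUnit_hom_apply a hv, leftUnit_hom_apply a (hv.lin f), map_smul, map_smul]))
  (rightUnitor_naturality := fun {V W} f => Hom.ext (ext₂ (W := one ω) fun x v y a hv ha => by
    change lin (rightUnit W).hom (lin f v ⊗ₜ[K] a) = lin f (lin (rightUnit V).hom (v ⊗ₜ[K] a))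
    rw [rightUnit_hom_apply a hv, rightUnit_hom_apply a (hv.lin f), map_smul, map_smul]))
  (pentagon := fun U V W Z => Hom.ext (ext₄ fun x u y v z w t r hu hv hw hr => by
    change TensorProduct.map LinearMap.id (assocLin V W Z) (assocLin U (tensor V W) Z
        (assocLin U V W ((u ⊗ₜ v) ⊗ₜ w) ⊗ₜ r)) =
      assocLin U V (tensor W Z) (assocLin (tensor U V) W Z (((u ⊗ₜ v) ⊗ₜ w) ⊗ₜ r))
    rw [assocLin_apply hu hv hw, ← TensorProduct.smul_tmul', map_smul, map_smul,
      assocLin_apply hu (isDeg_tmul hv hw) hr, map_smul, TensorProduct.map_tmul,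
      assocLin_apply hv hw hr, assocLin_apply (isDeg_tmul hu hv) hw hr, map_smul,
      assocLin_apply hu hv (isDeg_tmul hw hr)]
    simp only [LinearMap.id_apply, TensorProduct.tmul_smul, smul_smul]
    congr 1
    linear_combination cocycle_val (ω := ω) x y z t))
  (triangle := fun U V => Hom.ext (ext₃ (V := one ω) fun x u y a z v hu ha hv => by
    change TensorProduct.map LinearMap.id (lin (leftUnit V).hom)
        (assocLin U (one ω) V ((u ⊗ₜ a) ⊗ₜ v)) =
      TensorProduct.map (lin (rightUnit U).hom) LinearMap.id ((u ⊗ₜ a) ⊗ₜ v)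
    by_cases e : y = 1
    · subst e
      rw [assocLin_apply hu ha hv, map_smul, TensorProduct.map_tmul, TensorProduct.map_tmul,
        leftUnit_hom_apply a hv, rightUnit_hom_apply a hu]
      simp only [LinearMap.id_apply, TensorProduct.tmul_smul, smul_smul,
        ← TensorProduct.smul_tmul']
      congr 1
      rw [cocycle_one]
      field_simp
    · rw [isDeg_one_ne e ha]
      simp))

instance : MonoidalPreadditive (VecTw ω) where
  whiskerLeft_zero := Hom.ext (TensorProduct.map_zero_right _)
  zero_whiskerRight := Hom.ext (TensorProduct.map_zero_left _)
  whiskerLeft_add _ _ := Hom.ext (TensorProduct.map_add_right _ _ _)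
  add_whiskerRight _ _ := Hom.ext (TensorProduct.map_add_left _ _ _)

instance : MonoidalLinear K (VecTw ω) where
  whiskerLeft_smul _ _ _ _ _ := Hom.ext (TensorProduct.map_smul_right _ _ _)
  smul_whiskerRight _ _ _ _ _ := Hom.ext (TensorProduct.map_smul_left _ _ _)

/-! ### Change of the grading -/

section Regrade

variable {X' : Type*} [Group X'] [Fintype X'] {ω' : Cocycle3 K X'}

/-- The same vector space, with the component of degree `x` moved to degree `e x`. -/
abbrev regradeObj (ω' : Cocycle3 K X') (e : X ≃ X') (V : VecTw ω) : VecTw ω' where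
  carrier := V
  proj := fun x => V.proj (e.symm x)
  isProj := by
    rw [CompleteOrthogonalIdempotents.iff_ortho_complete]
    exact ⟨fun x y h => V.isProj.ortho (e.symm.injective.ne h),
      (Equiv.sum_comp e.symm V.proj).trans V.isProj.complete⟩

/-- The functor which keeps the underlying vector spaces and linear maps, and moves the component
of degree `x` to degree `e x`. -/
def regrade (ω' : Cocycle3 K X') (e : X ≃ X') : VecTw ω ⥤ VecTw ω' where
  obj V := regradeObj ω' e V
  map {V W} φ := (⟨(lin φ : V →ₗ[K] W), fun x v => proj_lin φ (e.symm x) v⟩ :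
    Hom (regradeObj ω' e V) (regradeObj ω' e W))
  map_id _ := rfl
  map_comp _ _ := rfl

theorem isDeg_regrade (e : X ≃ X') {x : X} {v : V} (hv : V.IsDeg x v) :
    (regradeObj ω' e V).IsDeg (e x) v := by
  change V.proj (e.symm (e x)) v = v
  rw [e.symm_apply_apply]; exact hv

theorem isDeg_of_regrade (e : X ≃ X') {x : X'} {v : V}
    (hv : (regradeObj ω' e V).IsDeg x v) : V.IsDeg (e.symm x) v := hv

instance (e : X ≃ X') : (regrade (ω := ω) ω' e).Additive where
  map_add := rfl

instance (e : X ≃ X') : (regrade (ω := ω) ω' e).Linear K where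
  map_smul _ _ := rfl

end Regrade

end VecTw

/-! ## Crossed categories -/

/-- The natural transformation `T g ⟶ T h` given by an equality `g = h`. -/
abbrev transport {G : Type*} {C : Type*} [Category C] (T : G → C ⥤ C) {g h : G} (e : g = h) :
    T g ⟶ T h := eqToHom (congrArg T e)

open Functor.OplaxMonoidal in
/-- The structure of a crossed category (braided `G`-crossed category) on a `K`-linear monoidal
category `C`. Tensor functors are Mathlib's (strong) monoidal functors; their tensor structure
`F (X ⊗ Y) ⟶ F X ⊗ F Y` is `δ F X Y`, and their unit-preserving structure `F 1 ⟶ 1` is `η F`.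
(The category `C` is not required to be fusion; crossed functors do not involve this.) -/
structure CrossedCategory (K : Type*) [Field K] (G : Type*) [Group G] (C : Type*) [Category C]
    [Preadditive C] [Linear K C] [MonoidalCategory C] [MonoidalPreadditive C]
    [MonoidalLinear K C] where
  /-- the grading `C = ⨁ C_g`, possibly not faithful, by full replete subcategories -/
  grade : G → ObjectProperty C
  grade_iso : ∀ g, (grade g).IsClosedUnderIsomorphisms
  grade_orth : ∀ {g h : G}, g ≠ h → ∀ {X Y : C}, grade g X → grade h Y → ∀ φ : X ⟶ Y, φ = 0
  grade_decomp : ∀ X : C, ∃ (Y : G → C) (b : Limits.Bicone Y), (∀ g, grade g (Y g)) ∧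
    Nonempty b.IsBilimit ∧ Nonempty (b.pt ≅ X)
  grade_unit : grade 1 (𝟙_ C)
  grade_tensor : ∀ {g h : G} {X Y : C}, grade g X → grade h Y → grade (g * h) (X ⊗ Y)
  /-- the action `g ↦ T_g` by `K`-linear tensor functors; each `T_g` is an autoequivalence by `γ`
  and `ι` -/
  T : G → C ⥤ C
  [T_additive : ∀ g, (T g).Additive]
  [T_linear : ∀ g, (T g).Linear K]
  /-- the tensor structures `μ_g` and unit-preserving structures `ν_g` of the functors `T_g` -/
  [T_monoidal : ∀ g, (T g).Monoidal]
  T_grade : ∀ (g : G) {h : G} {X : C}, grade h X → grade (g * h * g⁻¹) ((T g).obj X)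
  /-- the tensor structure `γ_{g,h} : T_{gh} ≅ T_g ∘ T_h` of `g ↦ T_g` -/
  γ : ∀ g h : G, T (g * h) ≅ T h ⋙ T g
  γ_monoidal : ∀ g h, NatTrans.IsMonoidal (γ g h).hom
  /-- the unit-preserving structure `ι : T_e ≅ id` of `g ↦ T_g` -/
  ι : T 1 ≅ 𝟭 C
  ι_monoidal : NatTrans.IsMonoidal ι.hom
  γ_assoc : ∀ (g h k : G) (X : C),
    (γ g (h * k)).hom.app X ≫ (T g).map ((γ h k).hom.app X) =
      (transport T (mul_assoc g h k).symm).app X ≫ (γ (g * h) k).hom.app X ≫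
        (γ g h).hom.app ((T k).obj X)
  γ_one_left : ∀ (g : G) (X : C),
    (γ 1 g).hom.app X ≫ ι.hom.app ((T g).obj X) = (transport T (one_mul g)).app X
  γ_one_right : ∀ (g : G) (X : C),
    (γ g 1).hom.app X ≫ (T g).map (ι.hom.app X) = (transport T (mul_one g)).app X
  /-- the `G`-braiding `c(X, Y) : X ⊗ Y ≅ T_g Y ⊗ X` for `X ∈ C_g` -/
  braid : ∀ {g : G} {X : C}, grade g X → ∀ Y : C, X ⊗ Y ≅ (T g).obj Y ⊗ X
  braid_natural : ∀ {g : G} {X X' : C} (hX : grade g X) (hX' : grade g X') {Y Y' : C}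
    (φ : X ⟶ X') (ψ : Y ⟶ Y'),
    (braid hX Y).hom ≫ ((T g).map ψ ⊗ₘ φ) = (φ ⊗ₘ ψ) ≫ (braid hX' Y').hom
  T_braid : ∀ (g : G) {h : G} {X : C} (hX : grade h X) (Y : C),
    δ (T g) X Y ≫ (braid (T_grade g hX) ((T g).obj Y)).hom ≫
        (γ (g * h * g⁻¹) g).inv.app Y ▷ (T g).obj X ≫
        (transport T (inv_mul_cancel_right (g * h) g)).app Y ▷ (T g).obj X ≫
        (γ g h).hom.app Y ▷ (T g).obj X =
      (T g).map (braid hX Y).hom ≫ δ (T g) ((T h).obj Y) X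
  braid_tensor_left : ∀ {g h : G} {X Y : C} (hX : grade g X) (hY : grade h Y) (Z : C),
    (α_ X Y Z).inv ≫ (braid (grade_tensor hX hY) Z).hom ≫ (γ g h).hom.app Z ▷ (X ⊗ Y) ≫
        (α_ ((T g).obj ((T h).obj Z)) X Y).inv =
      X ◁ (braid hY Z).hom ≫ (α_ X ((T h).obj Z) Y).inv ≫ (braid hX ((T h).obj Z)).hom ▷ Y
  braid_tensor_right : ∀ {g : G} {X : C} (hX : grade g X) (Y Z : C),
    (α_ X Y Z).hom ≫ (braid hX (Y ⊗ Z)).hom ≫ δ (T g) Y Z ▷ X ≫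
        (α_ ((T g).obj Y) ((T g).obj Z) X).hom =
      (braid hX Y).hom ▷ Z ≫ (α_ ((T g).obj Y) X Z).hom ≫ (T g).obj Y ◁ (braid hX Z).hom

attribute [instance] CrossedCategory.T_additive CrossedCategory.T_linear
  CrossedCategory.T_monoidal

section CrossedFunctor

variable {K : Type*} [Field K] {G G' : Type*} [Group G] [Group G']
  {C : Type*} [Category C] [Preadditive C] [Linear K C] [MonoidalCategory C]
  [MonoidalPreadditive C] [MonoidalLinear K C]
  {C' : Type*} [Category C'] [Preadditive C'] [Linear K C'] [MonoidalCategory C']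
  [MonoidalPreadditive C'] [MonoidalLinear K C']

open Functor.OplaxMonoidal in
/-- A crossed tensor functor `(f, F, η, η₀, β)` between crossed categories. The tensor structure
`η` and the unit-preserving structure `η₀` are part of `F_monoidal`. -/
structure CrossedFunctor (S : CrossedCategory K G C) (S' : CrossedCategory K G' C') where
  f : G →* G'
  F : C ⥤ C'
  [F_additive : F.Additive]
  [F_linear : F.Linear K]
  [F_monoidal : F.Monoidal]
  β : ∀ g : G, S.T g ⋙ F ≅ F ⋙ S'.T (f g)
  β_monoidal : ∀ g, NatTrans.IsMonoidal (β g).hom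
  map_grade : ∀ {g : G} {X : C}, S.grade g X → S'.grade (f g) (F.obj X)
  map_braid : ∀ {g : G} {X : C} (hX : S.grade g X) (Y : C),
    F.map (S.braid hX Y).hom ≫ δ F ((S.T g).obj Y) X ≫ (β g).hom.app Y ▷ F.obj X =
      δ F X Y ≫ (S'.braid (map_grade hX) (F.obj Y)).hom
  map_γ : ∀ (g h : G) (X : C),
    F.map ((S.γ g h).hom.app X) ≫ (β g).hom.app ((S.T h).obj X) ≫
        (S'.T (f g)).map ((β h).hom.app X) =
      (β (g * h)).hom.app X ≫ (transport S'.T (map_mul f g h)).app (F.obj X) ≫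
        (S'.γ (f g) (f h)).hom.app (F.obj X)

/-- A crossed tensor functor is an equivalence if `f` is an isomorphism and `F` is an
equivalence. -/
def CrossedFunctor.IsEquivalence {S : CrossedCategory K G C} {S' : CrossedCategory K G' C'}
    (Φ : CrossedFunctor S S') : Prop :=
  Function.Bijective Φ.f ∧ Φ.F.IsEquivalence

/-- Two crossed categories are equivalent if there is an equivalence between them. -/
def CrossedCategory.Equivalent (S : CrossedCategory K G C) (S' : CrossedCategory K G' C') :
    Prop :=
  ∃ Φ : CrossedFunctor S S', Φ.IsEquivalence

end CrossedFunctor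

/-! ## The crossed pointed category `C(ω, γ, μ, c)` -/

namespace CrossedPointed

open VecTw

variable {K : Type u} [Field K] {G : Type v} {X : Type w} [Group G] [Group X] [Fintype X]
  {𝒳 : CrossedModule G X} (ξ : Z3qa K 𝒳)

/-- The component `ω` of a quasi-abelian 3-cocycle `(ω, γ, μ, c)`. -/
abbrev omega : Cocycle3 K X := ⟨ξ.1.1, ξ.2.cocycle_omega⟩
/-- The component `γ`. -/
abbrev gamma : G → G → X → Kˣ := ξ.1.2.1
/-- The component `μ`. -/
abbrev mu : G → X → X → Kˣ := ξ.1.2.2.1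
/-- The component `c`. -/
abbrev cc : X → X → Kˣ := ξ.1.2.2.2

section Identities

variable {ξ}

theorem mu_assoc (g : G) (x y z : X) :
    (mu ξ g y z : K) * mu ξ g x (y * z) * (omega ξ).1 x y z =
      (omega ξ).1 (𝒳.act g x) (𝒳.act g y) (𝒳.act g z) * (mu ξ g (x * y) z * mu ξ g x y) := by
  have h := ξ.2.d_mu g x y z
  rw [div_eq_div_iff_mul_eq_mul] at h
  exact_mod_cast congrArg Units.val h

theorem mu_one_left (g : G) (x : X) :
    (mu ξ g 1 x : K) * (omega ξ).1 1 1 x = (omega ξ).1 1 1 (𝒳.act g x) * mu ξ g 1 1 := by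
  have h := mu_assoc (ξ := ξ) g 1 1 x
  simp only [one_mul, mul_one, map_one] at h
  exact mul_left_cancel₀ (mu ξ g 1 x).ne_zero (by linear_combination h)

theorem mu_one_right (g : G) (x : X) :
    (mu ξ g 1 1 : K) * (omega ξ).1 x 1 1 = (omega ξ).1 (𝒳.act g x) 1 1 * mu ξ g x 1 := by
  have h := mu_assoc (ξ := ξ) g x 1 1
  simp only [mul_one, map_one] at h
  exact mul_left_cancel₀ (mu ξ g x 1).ne_zero (by linear_combination h)

theorem gamma_mul (g h : G) (x y : X) :
    (gamma ξ g h x : K) * gamma ξ g h y * mu ξ (g * h) x y =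
      mu ξ g (𝒳.act h x) (𝒳.act h y) * mu ξ h x y * gamma ξ g h (x * y) := by
  have h := ξ.2.d_gamma g h x y
  rw [div_eq_div_iff_mul_eq_mul] at h
  exact_mod_cast congrArg Units.val h

theorem gamma_one (g h : G) :
    (gamma ξ g h 1 : K) * mu ξ (g * h) 1 1 = mu ξ g 1 1 * mu ξ h 1 1 := by
  have e := gamma_mul (ξ := ξ) g h 1 1
  simp only [mul_one, map_one] at e
  exact mul_left_cancel₀ (gamma ξ g h 1).ne_zero (by linear_combination e)

theorem gamma_assoc (g h k : G) (x : X) :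
    (gamma ξ h k x : K) * gamma ξ g (h * k) x =
      gamma ξ g h (𝒳.act k x) * gamma ξ (g * h) k x := by
  exact_mod_cast congrArg Units.val (ξ.2.cocycle_gamma g h k x)

theorem gamma_one_left (k : G) (x : X) : (gamma ξ 1 k x : K) = gamma ξ 1 1 (𝒳.act k x) := by
  have h := gamma_assoc (ξ := ξ) 1 1 k x
  simp only [one_mul] at h
  exact mul_right_cancel₀ (gamma ξ 1 k x).ne_zero h

theorem gamma_one_right (g : G) (x : X) : (gamma ξ g 1 x : K) = gamma ξ 1 1 x := by
  have h := gamma_assoc (ξ := ξ) g 1 1 x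
  simp only [mul_one, map_one, MulAut.one_apply] at h
  exact (mul_right_cancel₀ (gamma ξ g 1 x).ne_zero h).symm

theorem cc_act (g : G) (x y : X) :
    (cc ξ (𝒳.act g x) (𝒳.act g y) : K) * mu ξ g x y * gamma ξ g (𝒳.bd x) y =
      mu ξ g (x * y * x⁻¹) x * gamma ξ (g * 𝒳.bd x * g⁻¹) g y * cc ξ x y := by
  have h := ξ.2.c_act g x y
  rw [div_mul_div_comm, div_eq_div_iff_mul_eq_mul, ← mul_assoc] at h
  exact_mod_cast congrArg Units.val h

theorem cc_mul_left (x y z : X) :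
    (cc ξ (x * y) z : K) *
        ((omega ξ).1 x (y * z * y⁻¹) y * gamma ξ (𝒳.bd x) (𝒳.bd y) z) =
      (omega ξ).1 x y z * (omega ξ).1 ((x * y) * z * (x * y)⁻¹) x y *
        (cc ξ x (y * z * y⁻¹) * cc ξ y z) := by
  have h := ξ.2.c_mul_left x y z
  rw [div_mul_eq_mul_div, eq_div_iff_mul_eq'] at h
  exact_mod_cast congrArg Units.val h

theorem cc_mul_right (x y z : X) :
    (cc ξ x (y * z) : K) *
        ((omega ξ).1 x y z * (omega ξ).1 (x * y * x⁻¹) (x * z * x⁻¹) x * mu ξ (𝒳.bd x) y z) =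
      (omega ξ).1 (x * y * x⁻¹) x z * (cc ξ x y * cc ξ x z) := by
  have h := ξ.2.c_mul_right x y z
  rw [div_mul_eq_mul_div, eq_div_iff_mul_eq'] at h
  exact_mod_cast congrArg Units.val h

end Identities

/-- `T_g`: the vector space `V` with the component of degree `x` moved to degree `ᵍx`. -/
abbrev tFun (g : G) : VecTw (omega ξ) ⥤ VecTw (omega ξ) :=
  regrade (omega ξ) (𝒳.act g).toEquiv

/-- `T_g V`. -/
abbrev tObj (g : G) (V : VecTw (omega ξ)) : VecTw (omega ξ) :=
  regradeObj (omega ξ) (𝒳.act g).toEquiv V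

variable {ξ} {U V W : VecTw (omega ξ)}

theorem isDeg_tObj (g : G) {x : X} {v : V} (hv : V.IsDeg x v) :
    (tObj ξ g V).IsDeg (𝒳.act g x) v := isDeg_regrade (𝒳.act g).toEquiv hv

theorem exists_isDeg_of_tObj (g : G) {x : X} {v : V} (hv : (tObj ξ g V).IsDeg x v) :
    ∃ y, 𝒳.act g y = x ∧ V.IsDeg y v :=
  ⟨(𝒳.act g).symm x, (𝒳.act g).apply_symm_apply x, hv⟩

/-- The isomorphism `1 ≅ T_g 1` inverse to the unit-preserving structure
`ν_g = μ_g(e,e)⁻¹`. -/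
def tUnit (g : G) : one (omega ξ) ≅ tObj ξ g (one (omega ξ)) :=
  mkIso
    (mkHom (W := tObj ξ g (one (omega ξ)))
      ((mu ξ g 1 1 : K) • (LinearMap.id : one (omega ξ) →ₗ[K] one (omega ξ))) fun x a ha => by
        by_cases e : x = 1
        · subst e
          have := isDeg_tObj g (ha.smul (mu ξ g 1 1 : K))
          rw [map_one] at this
          exact this
        · rw [isDeg_one_ne e ha]; simp [IsDeg])
    (mkHom (V := tObj ξ g (one (omega ξ))) (W := one (omega ξ))
      (((mu ξ g 1 1)⁻¹ : K) • (LinearMap.id : one (omega ξ) →ₗ[K] one (omega ξ)))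
      fun x a ha => by
        obtain ⟨y, rfl, hy⟩ := exists_isDeg_of_tObj g ha
        by_cases e : y = 1
        · subst e
          rw [map_one]
          exact hy.smul _
        · have : a = 0 := isDeg_one_ne e hy
          subst this
          simp [IsDeg])
    (fun x a _ => by
      change ((mu ξ g 1 1)⁻¹ : K) • (mu ξ g 1 1 : K) • a = a
      rw [smul_smul]; simp)
    (fun x a _ => by
      change (mu ξ g 1 1 : K) • ((mu ξ g 1 1)⁻¹ : K) • a = a
      rw [smul_smul]; simp)

theorem scal₂_inv_apply (φ : X → X → Kˣ) (t : V ⊗[K] W) :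
    scal₂ (fun x y => (φ x y)⁻¹) V W (scal₂ φ V W t) = t := by
  have : scal₂ (fun x y => (φ x y)⁻¹) V W ∘ₗ scal₂ φ V W = LinearMap.id :=
    ext₂ fun x v y w hv hw => by
      rw [LinearMap.comp_apply, scal₂_apply _ hv hw, map_smul, scal₂_apply _ hv hw, smul_smul]
      simp
  exact LinearMap.congr_fun this t

theorem scal₂_apply_inv (φ : X → X → Kˣ) (t : V ⊗[K] W) :
    scal₂ φ V W (scal₂ (fun x y => (φ x y)⁻¹) V W t) = t := by
  have h := scal₂_inv_apply (V := V) (W := W) (fun x y => (φ x y)⁻¹) t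
  simpa only [inv_inv] using h

/-- The isomorphism `T_g V ⊗ T_g W ≅ T_g (V ⊗ W)`, inverse to the tensor structure
`μ_g(x,y) id` of `T_g`. -/
def tTensor (g : G) (V W : VecTw (omega ξ)) :
    tensor (tObj ξ g V) (tObj ξ g W) ≅ tObj ξ g (tensor V W) where
  hom := mkHom₂ (V := tObj ξ g V) (W := tObj ξ g W) (Z := tObj ξ g (tensor V W))
    (scal₂ (fun x y => (mu ξ g x y)⁻¹) V W) fun x v y w hv hw => by
      obtain ⟨x, rfl, hv'⟩ := exists_isDeg_of_tObj g hv
      obtain ⟨y, rfl, hw'⟩ := exists_isDeg_of_tObj g hw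
      rw [scal₂_apply (V := V) (W := W) _ hv' hw', ← map_mul]
      exact (isDeg_tObj g (isDeg_tmul hv' hw')).smul _
  inv := ⟨scal₂ (mu ξ g) V W, fun z t => LinearMap.congr_fun
    (f := (tensor (tObj ξ g V) (tObj ξ g W)).proj z ∘ₗ scal₂ (mu ξ g) V W)
    (g := scal₂ (mu ξ g) V W ∘ₗ (tObj ξ g (tensor V W)).proj z)
    (ext₂ fun x v y w hv hw => by
      refine comm_at (V := tObj ξ g (tensor V W)) (W := tensor (tObj ξ g V) (tObj ξ g W))
        (isDeg_tObj g (isDeg_tmul hv hw)) ?_ z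
      rw [scal₂_apply _ hv hw, map_mul]
      exact (isDeg_tmul (isDeg_tObj g hv) (isDeg_tObj g hw)).smul _) t⟩
  hom_inv_id := Hom.ext (LinearMap.ext fun t => scal₂_apply_inv (V := V) (W := W) (mu ξ g) t)
  inv_hom_id := Hom.ext (LinearMap.ext fun t => scal₂_inv_apply (V := V) (W := W) (mu ξ g) t)

variable (ξ) in
/-- `T_g` as a tensor functor. -/
@[reducible]
def tMonoidal (g : G) : (tFun ξ g).Monoidal :=
  Functor.CoreMonoidal.toMonoidal
  { εIso := tUnit g
    μIso := tTensor g
    μIso_hom_natural_left := fun {V V'} φ W => Hom.ext (ext₂ (V := V) (W := W) fun x v y w hv hw => by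
      change scal₂ (fun x y => (mu ξ g x y)⁻¹) V' W (lin φ v ⊗ₜ w) =
        TensorProduct.map (lin φ) LinearMap.id
          (scal₂ (fun x y => (mu ξ g x y)⁻¹) V W (v ⊗ₜ w))
      rw [scal₂_apply _ hv hw, scal₂_apply _ (hv.lin φ) hw, map_smul]; rfl)
    μIso_hom_natural_right := fun {W W'} V φ => Hom.ext (ext₂ (V := V) (W := W) fun x v y w hv hw => by
      change scal₂ (fun x y => (mu ξ g x y)⁻¹) V W' (v ⊗ₜ lin φ w) =
        TensorProduct.map LinearMap.id (lin φ)
          (scal₂ (fun x y => (mu ξ g x y)⁻¹) V W (v ⊗ₜ w))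
      rw [scal₂_apply _ hv hw, scal₂_apply _ hv (hw.lin φ), map_smul]; rfl)
    associativity := fun U V W => Hom.ext (ext₃ (U := U) (V := V) (W := W) fun x u y v z w hu hv hw => by
      change assocLin U V W (scal₂ (fun x y => (mu ξ g x y)⁻¹) (tensor U V) W
          (scal₂ (fun x y => (mu ξ g x y)⁻¹) U V (u ⊗ₜ v) ⊗ₜ w)) =
        scal₂ (fun x y => (mu ξ g x y)⁻¹) U (tensor V W) (TensorProduct.map LinearMap.id
          (scal₂ (fun x y => (mu ξ g x y)⁻¹) V W)
            (assocLin (tObj ξ g U) (tObj ξ g V) (tObj ξ g W) ((u ⊗ₜ v) ⊗ₜ w)))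
      rw [assocLin_apply (isDeg_tObj g hu) (isDeg_tObj g hv) (isDeg_tObj g hw), map_smul, map_smul,
        TensorProduct.map_tmul, scal₂_apply _ hu hv, scal₂_apply _ hv hw,
        ← TensorProduct.smul_tmul', map_smul, map_smul, TensorProduct.tmul_smul, map_smul,
        LinearMap.id_apply, scal₂_apply _ (isDeg_tmul hu hv) hw, scal₂_apply _ hu (isDeg_tmul hv hw),
        map_smul, assocLin_apply hu hv hw]
      simp only [smul_smul, Units.val_inv_eq_inv_val]
      congr 1
      have := mu_assoc (ξ := ξ) g x y z
      field_simp
      linear_combination this)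
    left_unitality := fun V => Hom.ext (ext₂ (V := one (omega ξ)) (W := V) fun x a y v ha hv => by
      by_cases e : x = 1
      · subst e
        change lin (leftUnit (tObj ξ g V)).hom (a ⊗ₜ[K] v) =
          lin (leftUnit V).hom (scal₂ (fun x y => (mu ξ g x y)⁻¹) (one (omega ξ)) V
            (((mu ξ g 1 1 : K) • a) ⊗ₜ[K] v))
        rw [leftUnit_hom_apply (V := tObj ξ g V) a (isDeg_tObj g hv),
          scal₂_apply _ (ha.smul _) hv, map_smul, leftUnit_hom_apply _ hv]
        simp only [smul_smul, Units.val_inv_eq_inv_val, smul_eq_mul]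
        congr 1
        have := mu_one_left (ξ := ξ) g y
        field_simp
        linear_combination a * this
      · rw [isDeg_one_ne e ha, TensorProduct.zero_tmul]
        exact (map_zero _).trans (map_zero _).symm)
    right_unitality := fun V => Hom.ext (ext₂ (V := V) (W := one (omega ξ)) fun x v y a hv ha => by
      by_cases e : y = 1
      · subst e
        change lin (rightUnit (tObj ξ g V)).hom (v ⊗ₜ[K] a) =
          lin (rightUnit V).hom (scal₂ (fun x y => (mu ξ g x y)⁻¹) V (one (omega ξ))
            (v ⊗ₜ[K] ((mu ξ g 1 1 : K) • a)))
        rw [rightUnit_hom_apply (V := tObj ξ g V) a (isDeg_tObj g hv),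
          scal₂_apply _ hv (ha.smul _), map_smul, rightUnit_hom_apply _ hv]
        simp only [smul_smul, Units.val_inv_eq_inv_val, smul_eq_mul]
        congr 1
        have := mu_one_right (ξ := ξ) g x
        field_simp
        linear_combination -a * this
      · rw [isDeg_one_ne e ha, TensorProduct.tmul_zero]
        exact (map_zero _).trans (map_zero _).symm) }

attribute [local instance] tMonoidal

theorem scal₁_inv_apply (φ : X → Kˣ) (v : V) :
    scal₁ (fun x => (φ x)⁻¹) V (scal₁ φ V v) = v := by
  have : scal₁ (fun x => (φ x)⁻¹) V ∘ₗ scal₁ φ V = LinearMap.id := lin_ext fun x v hv => by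
    rw [LinearMap.comp_apply, scal₁_apply _ hv, map_smul, scal₁_apply _ hv, smul_smul]
    simp
  exact LinearMap.congr_fun this v

theorem scal₁_apply_inv (φ : X → Kˣ) (v : V) :
    scal₁ φ V (scal₁ (fun x => (φ x)⁻¹) V v) = v := by
  have h := scal₁_inv_apply (V := V) (fun x => (φ x)⁻¹) v
  simpa only [inv_inv] using h

theorem scal₁_lin (φ : X → Kˣ) (f : V ⟶ W) (v : V) :
    scal₁ φ W (lin f v) = lin f (scal₁ φ V v) := by
  have : scal₁ φ W ∘ₗ lin f = lin f ∘ₗ scal₁ φ V := lin_ext fun x v hv => by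
    rw [LinearMap.comp_apply, LinearMap.comp_apply, scal₁_apply _ hv, scal₁_apply _ (hv.lin f),
      map_smul]
  exact LinearMap.congr_fun this v

variable (ξ) in
/-- The tensor structure `γ_{g,h}(x) id : T_{gh} ≅ T_g ∘ T_h`. -/
def tGamma (g h : G) : tFun ξ (g * h) ≅ tFun ξ h ⋙ tFun ξ g :=
  NatIso.ofComponents
    (fun V => mkIso
      (mkHom (V := tObj ξ (g * h) V) (W := tObj ξ g (tObj ξ h V)) (scal₁ (gamma ξ g h) V)
        fun x v hv => by
          obtain ⟨y, rfl, hv'⟩ := exists_isDeg_of_tObj _ hv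
          rw [scal₁_apply (V := V) _ hv', map_mul, MulAut.mul_apply]
          exact (isDeg_tObj g (isDeg_tObj h hv')).smul _)
      (mkHom (V := tObj ξ g (tObj ξ h V)) (W := tObj ξ (g * h) V)
        (scal₁ (fun x => (gamma ξ g h x)⁻¹) V) fun x v hv => by
          obtain ⟨y, rfl, hv'⟩ := exists_isDeg_of_tObj _ hv
          obtain ⟨z, rfl, hv''⟩ := exists_isDeg_of_tObj _ hv'
          rw [scal₁_apply (V := V) _ hv'', ← MulAut.mul_apply, ← map_mul]
          exact (isDeg_tObj (g * h) hv'').smul _)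
      (fun _ v _ => scal₁_inv_apply (V := V) (gamma ξ g h) v)
      (fun _ v _ => scal₁_apply_inv (V := V) (gamma ξ g h) v))
    (fun {V W} φ => Hom.ext (LinearMap.ext fun v => scal₁_lin (gamma ξ g h) φ v))

variable (ξ) in
/-- The unit-preserving structure `γ_{e,e}(x)⁻¹ id : T_e ≅ id`. -/
def tIota : tFun ξ 1 ≅ 𝟭 (VecTw (omega ξ)) :=
  NatIso.ofComponents
    (fun V => mkIso
      (mkHom (V := tObj ξ 1 V) (W := V) (scal₁ (fun x => (gamma ξ 1 1 x)⁻¹) V)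
        fun x v hv => by
          obtain ⟨y, rfl, hv'⟩ := exists_isDeg_of_tObj _ hv
          rw [scal₁_apply (V := V) _ hv', map_one, MulAut.one_apply]
          exact hv'.smul _)
      (mkHom (V := V) (W := tObj ξ 1 V) (scal₁ (gamma ξ 1 1) V) fun x v hv => by
          have := (isDeg_tObj 1 hv).smul (gamma ξ 1 1 x : K)
          rw [map_one, MulAut.one_apply] at this
          rw [scal₁_apply (V := V) _ hv]
          exact this)
      (fun _ v _ => scal₁_apply_inv (V := V) (gamma ξ 1 1) v)
      (fun _ v _ => scal₁_inv_apply (V := V) (gamma ξ 1 1) v))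
    (fun {V W} φ => Hom.ext (LinearMap.ext fun v =>
      scal₁_lin (fun x => (gamma ξ 1 1 x)⁻¹) φ v))

theorem tGamma_monoidal (g h : G) : NatTrans.IsMonoidal (tGamma ξ g h).hom where
  unit := Hom.ext (lin_ext (V := one (omega ξ)) fun x a ha => by
    by_cases e : x = 1
    · subst e
      change scal₁ (gamma ξ g h) (one (omega ξ)) ((mu ξ (g * h) 1 1 : K) • a) =
        (mu ξ h 1 1 : K) • (mu ξ g 1 1 : K) • a
      rw [scal₁_apply _ (ha.smul _), smul_smul, smul_smul]
      congr 1
      linear_combination gamma_one (ξ := ξ) g h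
    · rw [isDeg_one_ne e ha]
      exact (map_zero _).trans (map_zero _).symm)
  tensor V W := Hom.ext (ext₂ (V := V) (W := W) fun x v y w hv hw => by
    change scal₁ (gamma ξ g h) (tensor V W) (scal₂ (fun x y => (mu ξ (g * h) x y)⁻¹) V W
        (v ⊗ₜ w)) =
      scal₂ (fun x y => (mu ξ h x y)⁻¹) V W
        (scal₂ (fun x y => (mu ξ g x y)⁻¹) (tObj ξ h V) (tObj ξ h W)
          (scal₁ (gamma ξ g h) V v ⊗ₜ scal₁ (gamma ξ g h) W w))
    rw [scal₂_apply _ hv hw, map_smul, scal₁_apply _ (isDeg_tmul hv hw), scal₁_apply _ hv,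
      scal₁_apply _ hw, scal₂_apply (V := tObj ξ h V) (W := tObj ξ h W) _
        (isDeg_tObj h (hv.smul _)) (isDeg_tObj h (hw.smul _)), map_smul,
      scal₂_apply _ (hv.smul _) (hw.smul _), ← TensorProduct.smul_tmul', TensorProduct.tmul_smul]
    simp only [smul_smul, Units.val_inv_eq_inv_val]
    congr 1
    have := gamma_mul (ξ := ξ) g h x y
    field_simp
    linear_combination -this)

theorem tIota_monoidal : NatTrans.IsMonoidal (tIota ξ).hom where
  unit := Hom.ext (lin_ext (V := one (omega ξ)) fun x a ha => by
    by_cases e : x = 1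
    · subst e
      change scal₁ (fun x => (gamma ξ 1 1 x)⁻¹) (one (omega ξ)) ((mu ξ 1 1 1 : K) • a) = a
      rw [scal₁_apply _ (ha.smul _), smul_smul]
      have h1 := gamma_one (ξ := ξ) 1 1
      rw [mul_one] at h1
      have h2 : (gamma ξ 1 1 1 : K) = mu ξ 1 1 1 := mul_right_cancel₀ (mu ξ 1 1 1).ne_zero h1
      rw [Units.val_inv_eq_inv_val, h2]
      simp
    · rw [isDeg_one_ne e ha]
      exact (map_zero _).trans (map_zero _).symm)
  tensor V W := Hom.ext (ext₂ (V := V) (W := W) fun x v y w hv hw => by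
    change scal₁ (fun x => (gamma ξ 1 1 x)⁻¹) (tensor V W)
        (scal₂ (fun x y => (mu ξ 1 x y)⁻¹) V W (v ⊗ₜ w)) =
      scal₁ (fun x => (gamma ξ 1 1 x)⁻¹) V v ⊗ₜ scal₁ (fun x => (gamma ξ 1 1 x)⁻¹) W w
    rw [scal₂_apply _ hv hw, map_smul, scal₁_apply _ (isDeg_tmul hv hw), scal₁_apply _ hv,
      scal₁_apply _ hw, ← TensorProduct.smul_tmul', TensorProduct.tmul_smul]
    simp only [smul_smul, Units.val_inv_eq_inv_val]
    congr 1
    have h1 := gamma_mul (ξ := ξ) 1 1 x y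
    simp only [mul_one, map_one, MulAut.one_apply] at h1
    have h2 : (gamma ξ 1 1 x : K) * gamma ξ 1 1 y = mu ξ 1 x y * gamma ξ 1 1 (x * y) :=
      mul_right_cancel₀ (mu ξ 1 x y).ne_zero (by linear_combination h1)
    field_simp
    linear_combination h2)

variable (ξ) in
/-- `C_g`: the objects supported on `∂⁻¹(g)`. -/
def tGrade (g : G) : ObjectProperty (VecTw (omega ξ)) :=
  fun V => ∀ x, 𝒳.bd x ≠ g → V.proj x = 0

theorem bd_eq_or {g : G} (hV : tGrade ξ g V) {x : X} {v : V} (hv : V.IsDeg x v) :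
    𝒳.bd x = g ∨ v = 0 := by
  by_cases e : 𝒳.bd x = g
  · exact Or.inl e
  · right
    rw [← show V.proj x v = v from hv, hV x e]
    rfl

theorem tGrade_iff {g : G} : tGrade ξ g V ↔ ∀ x v, V.IsDeg x v → 𝒳.bd x ≠ g → v = 0 := by
  refine ⟨fun hV x v hv e => (bd_eq_or hV hv).resolve_left e, fun h x e => ?_⟩
  exact LinearMap.ext fun v => h x _ (V.isDeg_proj x v) e

/-- The part of `V` supported on `∂⁻¹(g)`. -/
def part (g : G) (V : VecTw (omega ξ)) : VecTw (omega ξ) where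
  carrier := (⨅ x : {x // 𝒳.bd x ≠ g}, LinearMap.ker (V.proj x) : Submodule K V)
  proj x := (V.proj x).restrict fun v hv => by
    simp only [Submodule.mem_iInf, LinearMap.mem_ker, Subtype.forall] at hv ⊢
    intro y hy
    by_cases e : y = x
    · subst e; rw [hv y hy, map_zero]
    · exact V.proj_proj_ne e v
  isProj := by
    rw [CompleteOrthogonalIdempotents.iff_ortho_complete]
    refine ⟨fun x y h => LinearMap.ext fun v => Subtype.ext (V.proj_proj_ne h v.1),
      LinearMap.ext fun v => Subtype.ext ?_⟩
    rw [LinearMap.sum_apply, AddSubmonoidClass.coe_finsetSum]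
    exact V.sum_proj v.1

theorem part_grade (g : G) (V : VecTw (omega ξ)) : tGrade ξ g (part g V) := by
  intro x hx
  refine LinearMap.ext fun v => Subtype.ext ?_
  have := v.2
  simp only [Submodule.mem_iInf, LinearMap.mem_ker, Subtype.forall] at this
  exact this x hx

open Classical in
theorem tGrade_decomp [Finite G] (V : VecTw (omega ξ)) :
    ∃ (Y : G → VecTw (omega ξ)) (b : Limits.Bicone Y), (∀ g, tGrade ξ g (Y g)) ∧
      Nonempty b.IsBilimit ∧ Nonempty (b.pt ≅ V) := by
  cases nonempty_fintype G
  have key : ∀ (g : G) (v : V), ∑ x with 𝒳.bd x = g, V.proj x v ∈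
      (⨅ x : {x // 𝒳.bd x ≠ g}, LinearMap.ker (V.proj x) : Submodule K V) := fun g v => by
    simp only [Submodule.mem_iInf, LinearMap.mem_ker, Subtype.forall, map_sum]
    intro y hy
    refine Finset.sum_eq_zero fun x hx => V.proj_proj_ne ?_ v
    rintro rfl
    exact hy (Finset.mem_filter.1 hx).2
  let ι : ∀ g, part g V ⟶ V := fun g => ⟨Submodule.subtype _, fun _ _ => rfl⟩
  let π : ∀ g, V ⟶ part g V := fun g =>
    ⟨LinearMap.codRestrict _ (∑ x with 𝒳.bd x = g, V.proj x) fun v => by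
        rw [LinearMap.sum_apply]; exact key g v, fun x v => Subtype.ext (by
        change V.proj x ((∑ x with 𝒳.bd x = g, V.proj x) v) =
          (∑ x with 𝒳.bd x = g, V.proj x) (V.proj x v)
        rw [LinearMap.sum_apply, LinearMap.sum_apply, map_sum]
        refine Finset.sum_congr rfl fun y _ => ?_
        by_cases e : x = y
        · rw [e]
        · rw [V.proj_proj_ne e, V.proj_proj_ne (Ne.symm e)])⟩
  have hπ : ∀ g (v : V), (lin (π g) v).1 = ∑ x with 𝒳.bd x = g, V.proj x v := fun g v =>
    LinearMap.sum_apply _ _ _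
  let b : Limits.Bicone fun g => part g V :=
    { pt := V
      π := π
      ι := ι
      ι_π := fun g h => by
        split_ifs with e
        · subst e
          refine Hom.ext (LinearMap.ext fun v => Subtype.ext ?_)
          have hv := v.2
          simp only [Submodule.mem_iInf, LinearMap.mem_ker, Subtype.forall] at hv
          refine (hπ g v.1).trans ?_
          rw [Finset.sum_filter_of_ne fun x _ hx => by by_contra h'; exact hx (hv x h')]
          exact V.sum_proj v.1
        · refine Hom.ext (LinearMap.ext fun v => Subtype.ext ?_)
          have hv := v.2
          simp only [Submodule.mem_iInf, LinearMap.mem_ker, Subtype.forall] at hv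
          refine (hπ h v.1).trans (Finset.sum_eq_zero fun x hx => hv x ?_)
          rw [(Finset.mem_filter.1 hx).2]
          exact fun h' => e h'.symm }
  refine ⟨fun g => part g V, b, fun g => part_grade g V, ⟨Limits.isBilimitOfTotal b ?_⟩,
    ⟨Iso.refl _⟩⟩
  refine Hom.ext (LinearMap.ext fun v => ?_)
  refine (lin_sum _ _ v).trans ?_
  refine Eq.trans (Finset.sum_congr rfl fun g _ => hπ g v) ?_
  exact (Finset.sum_fiberwise Finset.univ 𝒳.bd fun x => V.proj x v).trans (V.sum_proj v)

/-- The `G`-braiding `v ⊗ w ↦ c(x,y) w ⊗ v`. -/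
def tBraid {g : G} (hV : tGrade ξ g V) (W : VecTw (omega ξ)) :
    tensor V W ≅ tensor (tObj ξ g W) V where
  hom := mkHom₂ (Z := tensor (tObj ξ g W) V)
    ((TensorProduct.comm K V W).toLinearMap ∘ₗ scal₂ (cc ξ) V W) fun x v y w hv hw => by
      rcases bd_eq_or hV hv with rfl | rfl
      · rw [LinearMap.comp_apply, scal₂_apply _ hv hw, map_smul]
        have := isDeg_tmul (isDeg_tObj (𝒳.bd x) hw) hv
        rw [𝒳.act_bd, inv_mul_cancel_right] at this
        exact this.smul _
      · rw [TensorProduct.zero_tmul, map_zero]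
        simp [IsDeg]
  inv := mkHom₂ (V := tObj ξ g W) (W := V) (Z := tensor V W)
    (scal₂ (fun x y => (cc ξ x y)⁻¹) V W ∘ₗ (TensorProduct.comm K W V).toLinearMap)
    fun y w x v hw hv => by
      obtain ⟨y, rfl, hw'⟩ := exists_isDeg_of_tObj g hw
      rcases bd_eq_or hV hv with rfl | rfl
      · rw [LinearMap.comp_apply, LinearEquiv.coe_coe, TensorProduct.comm_tmul,
          scal₂_apply _ hv hw', 𝒳.act_bd, inv_mul_cancel_right]
        exact (isDeg_tmul hv hw').smul _
      · rw [TensorProduct.tmul_zero, map_zero]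
        simp [IsDeg]
  hom_inv_id := Hom.ext (LinearMap.ext fun t => by
    change scal₂ (fun x y => (cc ξ x y)⁻¹) V W (TensorProduct.comm K W V
      (TensorProduct.comm K V W (scal₂ (cc ξ) V W t))) = t
    rw [← TensorProduct.comm_symm, LinearEquiv.symm_apply_apply, scal₂_inv_apply])
  inv_hom_id := Hom.ext (LinearMap.ext fun t => by
    change TensorProduct.comm K V W (scal₂ (cc ξ) V W (scal₂ (fun x y => (cc ξ x y)⁻¹) V W
      (TensorProduct.comm K W V t))) = t
    rw [scal₂_apply_inv, ← TensorProduct.comm_symm, LinearEquiv.symm_apply_apply])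

theorem tBraid_apply {g : G} (hV : tGrade ξ g V) {x y : X} {v : V} {w : W} (hv : V.IsDeg x v)
    (hw : W.IsDeg y w) :
    lin (tBraid hV W).hom (v ⊗ₜ[K] w) = (cc ξ x y : K) • (w ⊗ₜ[K] v) := by
  change TensorProduct.comm K V W (scal₂ (cc ξ) V W (v ⊗ₜ w)) = _
  rw [scal₂_apply _ hv hw, map_smul]
  rfl

theorem lin_transport {g h : G} (e : g = h) (V : VecTw (omega ξ)) (v : V) :
    lin ((transport (tFun ξ) e).app V) v = v := by
  subst e; rfl

theorem tGamma_assoc (g h k : G) (V : VecTw (omega ξ)) :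
    (tGamma ξ g (h * k)).hom.app V ≫ (tFun ξ g).map ((tGamma ξ h k).hom.app V) =
      (transport (tFun ξ) (mul_assoc g h k).symm).app V ≫ (tGamma ξ (g * h) k).hom.app V ≫
        (tGamma ξ g h).hom.app ((tFun ξ k).obj V) :=
  Hom.ext (lin_ext (V := V) fun x v hv => by
    change scal₁ (gamma ξ h k) V (scal₁ (gamma ξ g (h * k)) V v) =
      scal₁ (gamma ξ g h) (tObj ξ k V) (scal₁ (gamma ξ (g * h) k) V
        (lin ((transport (tFun ξ) (mul_assoc g h k).symm).app V) v))
    rw [lin_transport, scal₁_apply _ hv, scal₁_apply _ hv, map_smul, scal₁_apply _ hv, smul_smul]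
    rw [scal₁_apply (V := tObj ξ k V) _ (isDeg_tObj k (hv.smul _)), smul_smul]
    congr 1
    linear_combination gamma_assoc (ξ := ξ) g h k x)

theorem tGamma_one_left (g : G) (V : VecTw (omega ξ)) :
    (tGamma ξ 1 g).hom.app V ≫ (tIota ξ).hom.app ((tFun ξ g).obj V) =
      (transport (tFun ξ) (one_mul g)).app V :=
  Hom.ext (lin_ext (V := V) fun x v hv => by
    refine Eq.trans ?_ (lin_transport (ξ := ξ) (one_mul g) V v).symm
    change scal₁ (fun x => (gamma ξ 1 1 x)⁻¹) (tObj ξ g V) (scal₁ (gamma ξ 1 g) V v) = v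
    rw [scal₁_apply _ hv]
    rw [scal₁_apply (V := tObj ξ g V) _ (isDeg_tObj g (hv.smul _)), gamma_one_left, smul_smul]
    simp)

theorem tGamma_one_right (g : G) (V : VecTw (omega ξ)) :
    (tGamma ξ g 1).hom.app V ≫ (tFun ξ g).map ((tIota ξ).hom.app V) =
      (transport (tFun ξ) (mul_one g)).app V :=
  Hom.ext (lin_ext (V := V) fun x v hv => by
    refine Eq.trans ?_ (lin_transport (ξ := ξ) (mul_one g) V v).symm
    change scal₁ (fun x => (gamma ξ 1 1 x)⁻¹) V (scal₁ (gamma ξ g 1) V v) = v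
    rw [scal₁_apply _ hv, scal₁_apply _ (hv.smul _), gamma_one_right, smul_smul]
    simp)

theorem tGrade_tObj (g : G) {h : G} (hV : tGrade ξ h V) :
    tGrade ξ (g * h * g⁻¹) (tObj ξ g V) := by
  rw [tGrade_iff] at hV ⊢
  intro x v hv hx
  obtain ⟨y, rfl, hv'⟩ := exists_isDeg_of_tObj g hv
  refine hV y v hv' fun e => hx ?_
  rw [𝒳.bd_act, e]

theorem tGrade_tensor {g h : G} (hV : tGrade ξ g V) (hW : tGrade ξ h W) :
    tGrade ξ (g * h) (tensor V W) := by
  intro z hz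
  refine ext₂ (V := V) (W := W) fun x v y w hv hw => ?_
  rcases bd_eq_or hV hv with hx | rfl
  · rcases bd_eq_or hW hw with hy | rfl
    · refine (isDeg_tmul hv hw).proj_ne ?_
      rintro rfl
      exact hz (by rw [map_mul, hx, hy])
    · rw [TensorProduct.tmul_zero]; exact (map_zero _).trans (map_zero _).symm
  · rw [TensorProduct.zero_tmul]; exact (map_zero _).trans (map_zero _).symm

theorem tBraid_T (g : G) {h : G} (hV : tGrade ξ h V) (W : VecTw (omega ξ)) :
    Functor.OplaxMonoidal.δ (tFun ξ g) V W ≫ (tBraid (tGrade_tObj g hV) (tObj ξ g W)).hom ≫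
        (tGamma ξ (g * h * g⁻¹) g).inv.app W ▷ (tFun ξ g).obj V ≫
        (transport (tFun ξ) (inv_mul_cancel_right (g * h) g)).app W ▷ (tFun ξ g).obj V ≫
        (tGamma ξ g h).hom.app W ▷ (tFun ξ g).obj V =
      (tFun ξ g).map (tBraid hV W).hom ≫
        Functor.OplaxMonoidal.δ (tFun ξ g) ((tFun ξ h).obj W) V :=
  Hom.ext (ext₂ (V := V) (W := W) fun x v y w hv hw => by
    rcases bd_eq_or hV hv with rfl | rfl
    · have hT : lin ((transport (tFun ξ) (inv_mul_cancel_right (g * 𝒳.bd x) g)).app W ▷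
          (tFun ξ g).obj V) (w ⊗ₜ[K] v) = w ⊗ₜ[K] v := by
        refine (TensorProduct.map_tmul _ _ _ _).trans ?_
        exact congrArg (· ⊗ₜ[K] v) (lin_transport _ W w)
      have aux : ∀ (f f' : V.carrier ⊗[K] W.carrier →ₗ[K] W.carrier ⊗[K] V.carrier)
          (t : W.carrier ⊗[K] V.carrier →ₗ[K] W.carrier ⊗[K] V.carrier),
          f (v ⊗ₜ w) = (cc ξ (𝒳.act g x) (𝒳.act g y) : K) • (w ⊗ₜ[K] v) →
          f' (v ⊗ₜ w) = (cc ξ x y : K) • (w ⊗ₜ[K] v) → t (w ⊗ₜ v) = w ⊗ₜ v →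
          TensorProduct.map (scal₁ (gamma ξ g (𝒳.bd x)) W) LinearMap.id
            (t (TensorProduct.map (scal₁ (fun z => (gamma ξ (g * 𝒳.bd x * g⁻¹) g z)⁻¹) W)
              LinearMap.id (f (scal₂ (mu ξ g) V W (v ⊗ₜ w))))) =
          scal₂ (mu ξ g) (tObj ξ (𝒳.bd x) W) V (f' (v ⊗ₜ w)) := by
        intro f f' t hf hf' ht
        rw [hf', scal₂_apply _ hv hw]
        simp only [map_smul]
        rw [hf]
        simp only [map_smul, TensorProduct.map_tmul, LinearMap.id_apply]
        rw [scal₁_apply _ hw, ← TensorProduct.smul_tmul',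
          scal₂_apply (V := tObj ξ (𝒳.bd x) W) (W := V) _ (isDeg_tObj (𝒳.bd x) hw) hv]
        simp only [map_smul]
        rw [ht, TensorProduct.map_tmul, scal₁_apply _ hw,
          LinearMap.id_apply, ← TensorProduct.smul_tmul']
        simp only [smul_smul, Units.val_inv_eq_inv_val]
        congr 1
        have h := cc_act (ξ := ξ) g x y
        rw [𝒳.act_bd]
        field_simp
        linear_combination h
      exact aux _ _ _ (tBraid_apply (tGrade_tObj g hV) (isDeg_tObj g hv) (isDeg_tObj g hw))
        (tBraid_apply hV hv hw) hT
    · rw [TensorProduct.zero_tmul]; exact (map_zero _).trans (map_zero _).symm)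

theorem tBraid_left {g h : G} (hU : tGrade ξ g U) (hV : tGrade ξ h V) (W : VecTw (omega ξ)) :
    (α_ U V W).inv ≫ (tBraid (tGrade_tensor hU hV) W).hom ≫
        (tGamma ξ g h).hom.app W ▷ (U ⊗ V) ≫
        (α_ ((tFun ξ g).obj ((tFun ξ h).obj W)) U V).inv =
      U ◁ (tBraid hV W).hom ≫ (α_ U ((tFun ξ h).obj W) V).inv ≫
        (tBraid hU ((tFun ξ h).obj W)).hom ▷ V :=
  Hom.ext (ext₃' (U := U) (V := V) (W := W) fun x u y v z w hu hv hw => by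
    rcases bd_eq_or hU hu with rfl | rfl
    · rcases bd_eq_or hV hv with rfl | rfl
      · have aux : ∀ (f : (U.carrier ⊗[K] V.carrier) ⊗[K] W.carrier →ₗ[K]
              W.carrier ⊗[K] (U.carrier ⊗[K] V.carrier))
            (f₁ : V.carrier ⊗[K] W.carrier →ₗ[K] W.carrier ⊗[K] V.carrier)
            (f₂ : U.carrier ⊗[K] W.carrier →ₗ[K] W.carrier ⊗[K] U.carrier),
            f ((u ⊗ₜ v) ⊗ₜ w) = (cc ξ (x * y) z : K) • (w ⊗ₜ[K] (u ⊗ₜ[K] v)) →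
            f₁ (v ⊗ₜ w) = (cc ξ y z : K) • (w ⊗ₜ[K] v) →
            f₂ (u ⊗ₜ w) = (cc ξ x (y * z * y⁻¹) : K) • (w ⊗ₜ[K] u) →
            assocInvLin (tObj ξ (𝒳.bd x) (tObj ξ (𝒳.bd y) W)) U V
              (TensorProduct.map (scal₁ (gamma ξ (𝒳.bd x) (𝒳.bd y)) W) LinearMap.id
                (f (assocInvLin U V W (u ⊗ₜ (v ⊗ₜ w))))) =
            TensorProduct.map f₂ LinearMap.id (assocInvLin U (tObj ξ (𝒳.bd y) W) V
              (TensorProduct.map LinearMap.id f₁ (u ⊗ₜ (v ⊗ₜ w)))) := by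
          intro f f₁ f₂ hf hf₁ hf₂
          rw [assocInvLin_apply hu hv hw, map_smul, TensorProduct.map_tmul, hf, hf₁]
          simp only [map_smul, TensorProduct.tmul_smul, LinearMap.id_apply]
          rw [assocInvLin_apply (V := tObj ξ (𝒳.bd y) W) hu (isDeg_tObj (𝒳.bd y) hw) hv]
          simp only [map_smul, TensorProduct.map_tmul, LinearMap.id_apply]
          rw [hf₂, scal₁_apply _ hw]
          simp only [← TensorProduct.smul_tmul', map_smul]
          rw [assocInvLin_apply (U := tObj ξ (𝒳.bd x) (tObj ξ (𝒳.bd y) W))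
            (isDeg_tObj (𝒳.bd x) (isDeg_tObj (𝒳.bd y) hw)) hu hv]
          simp only [smul_smul, 𝒳.act_bd]
          congr 1
          have h := cc_mul_left (ξ := ξ) x y z
          rw [show x * y * z * (x * y)⁻¹ = x * (y * z * y⁻¹) * x⁻¹ by group] at h
          field_simp
          linear_combination h
        refine aux _ _ _ (tBraid_apply (tGrade_tensor hU hV) (isDeg_tmul hu hv) hw)
          (tBraid_apply hV hv hw) ?_
        have := tBraid_apply hU hu (isDeg_tObj (𝒳.bd y) hw)
        rw [𝒳.act_bd] at this
        exact this
      · rw [TensorProduct.zero_tmul, TensorProduct.tmul_zero]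
        exact (map_zero _).trans (map_zero _).symm
    · rw [TensorProduct.zero_tmul]; exact (map_zero _).trans (map_zero _).symm)

theorem tBraid_right {g : G} (hU : tGrade ξ g U) (V W : VecTw (omega ξ)) :
    (α_ U V W).hom ≫ (tBraid hU (V ⊗ W)).hom ≫
        Functor.OplaxMonoidal.δ (tFun ξ g) V W ▷ U ≫
        (α_ ((tFun ξ g).obj V) ((tFun ξ g).obj W) U).hom =
      (tBraid hU V).hom ▷ W ≫ (α_ ((tFun ξ g).obj V) U W).hom ≫
        (tFun ξ g).obj V ◁ (tBraid hU W).hom :=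
  Hom.ext (ext₃ (U := U) (V := V) (W := W) fun x u y v z w hu hv hw => by
    rcases bd_eq_or hU hu with rfl | rfl
    · have aux : ∀ (f : U.carrier ⊗[K] (V.carrier ⊗[K] W.carrier) →ₗ[K]
            (V.carrier ⊗[K] W.carrier) ⊗[K] U.carrier)
          (f₁ : U.carrier ⊗[K] V.carrier →ₗ[K] V.carrier ⊗[K] U.carrier)
          (f₂ : U.carrier ⊗[K] W.carrier →ₗ[K] W.carrier ⊗[K] U.carrier),
          f (u ⊗ₜ (v ⊗ₜ w)) = (cc ξ x (y * z) : K) • ((v ⊗ₜ[K] w) ⊗ₜ[K] u) →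
          f₁ (u ⊗ₜ v) = (cc ξ x y : K) • (v ⊗ₜ[K] u) →
          f₂ (u ⊗ₜ w) = (cc ξ x z : K) • (w ⊗ₜ[K] u) →
          assocLin (tObj ξ (𝒳.bd x) V) (tObj ξ (𝒳.bd x) W) U
            (TensorProduct.map (scal₂ (mu ξ (𝒳.bd x)) V W) LinearMap.id
              (f (assocLin U V W ((u ⊗ₜ v) ⊗ₜ w)))) =
          TensorProduct.map LinearMap.id f₂ (assocLin (tObj ξ (𝒳.bd x) V) U W
            (TensorProduct.map f₁ LinearMap.id ((u ⊗ₜ v) ⊗ₜ w))) := by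
        intro f f₁ f₂ hf hf₁ hf₂
        rw [assocLin_apply hu hv hw, map_smul, TensorProduct.map_tmul, hf, hf₁]
        simp only [map_smul, ← TensorProduct.smul_tmul', LinearMap.id_apply,
          TensorProduct.map_tmul]
        rw [assocLin_apply (U := tObj ξ (𝒳.bd x) V) (isDeg_tObj (𝒳.bd x) hv) hu hw,
          scal₂_apply _ hv hw]
        simp only [map_smul, ← TensorProduct.smul_tmul', TensorProduct.map_tmul,
          LinearMap.id_apply]
        rw [hf₂, assocLin_apply (U := tObj ξ (𝒳.bd x) V) (V := tObj ξ (𝒳.bd x) W)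
          (isDeg_tObj (𝒳.bd x) hv) (isDeg_tObj (𝒳.bd x) hw) hu]
        simp only [smul_smul, 𝒳.act_bd, TensorProduct.tmul_smul]
        congr 1
        linear_combination cc_mul_right (ξ := ξ) x y z
      exact aux _ _ _ (tBraid_apply hU hu (isDeg_tmul hv hw)) (tBraid_apply hU hu hv)
        (tBraid_apply hU hu hw)
    · rw [TensorProduct.zero_tmul, TensorProduct.zero_tmul]
      exact (map_zero _).trans (map_zero _).symm)

end CrossedPointed

open CrossedPointed in
/-- The crossed pointed category `C(ω, γ, μ, c)` associated to a quasi-abelian 3-cocycle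
`ξ = (ω, γ, μ, c)` on a finite crossed module. -/
def crossedPointed {K : Type u} [Field K] {G : Type v} {X : Type w} [Group G] [Finite G]
    [Group X] [Fintype X] {𝒳 : CrossedModule G X} (ξ : Z3qa K 𝒳) :
    CrossedCategory K G (VecTw (omega ξ)) where
  grade := tGrade ξ
  grade_iso g := ⟨fun {V W} e hV => tGrade_iff.2 fun x w hw hx => by
    have h0 := tGrade_iff.1 hV x _ (hw.lin e.inv) hx
    have h1 : VecTw.lin e.hom (VecTw.lin e.inv w) = w := by
      rw [← VecTw.lin_comp, e.inv_hom_id, VecTw.lin_id]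
    rw [← h1, h0, map_zero]⟩
  grade_orth {g h} hgh V W hV hW φ := VecTw.hom_ext fun x v hv => by
    rw [VecTw.lin_zero]
    rcases bd_eq_or hV hv with rfl | rfl
    · exact tGrade_iff.1 hW x _ (hv.lin φ) hgh
    · exact map_zero _
  grade_decomp := tGrade_decomp
  grade_unit := by
    rw [tGrade_iff]
    intro x a ha hx
    refine VecTw.isDeg_one_ne ?_ ha
    rintro rfl
    exact hx (map_one _)
  grade_tensor := tGrade_tensor
  T := tFun ξ
  T_monoidal := tMonoidal ξ
  T_grade g _ _ h := tGrade_tObj g h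
  γ := tGamma ξ
  γ_monoidal := tGamma_monoidal
  ι := tIota ξ
  ι_monoidal := tIota_monoidal
  γ_assoc := tGamma_assoc
  γ_one_left := tGamma_one_left
  γ_one_right := tGamma_one_right
  braid := tBraid
  braid_natural {g V V'} hV hV' {W W'} φ ψ :=
    VecTw.Hom.ext (VecTw.ext₂ (V := V) (W := W) fun x v y w hv hw => by
      change TensorProduct.map (VecTw.lin ψ) (VecTw.lin φ)
          (VecTw.lin (tBraid hV W).hom (v ⊗ₜ w)) =
        VecTw.lin (tBraid hV' W').hom (VecTw.lin φ v ⊗ₜ[K] VecTw.lin ψ w)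
      rw [tBraid_apply hV hv hw, tBraid_apply hV' (hv.lin φ) (hw.lin ψ), map_smul]
      rfl)
  T_braid g _ _ hV W := tBraid_T g hV W
  braid_tensor_left := tBraid_left
  braid_tensor_right := tBraid_right

end

/-! Every object of `Vec_X^ω` is a direct sum of lines, copies of `K` placed in a single degree, and
a line has only scalar endomorphisms. Between lines all structure of `C(ω,γ,μ,c)` is scalar. The
canonical maps `line (xy) ⟶ line x ⊗ line y` and `line (ᵍx) ⟶ T_g (line x)` intertwine the
associators, the tensor structures of the `T_g`, the action constraints and the braidings up to the
values of `ω`, `μ`, `γ` and `c` (`lineTensor_assoc`, `lineT_δ`, `lineT_γ`, `lineTensor_braid`). A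
crossed functor is therefore governed by what it does to lines.

Suppose that a crossed equivalence is given. Being linear and fully faithful, it sends each line to
an object with only scalar endomorphisms, which is again one-dimensional and homogeneous
(`exists_homogeneous_generator`). This gives a map `d` on degrees, bijective because the functor is
an equivalence (`exists_lineImage`). After a generator `e x` is chosen in each image, the tensor
structure and the isomorphisms `β_g` become nonzero scalars `η(x,y)` and `b_g(x)`
(`exists_coefficients`). Comparison of degrees shows that `d` is multiplicative, equivariant and
compatible with the boundary maps, so that `(f, d)` is an isomorphism of crossed modules. The
remaining axioms, evaluated at the generators, become four scalar identities. Compatibility with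
associators gives the one for `ω`, monoidality of `β_g` the one for `μ`, compatibility with the
action constraints the one for `γ`, and compatibility with the braidings the one for `c`. Together
they say that the pullback of `ξ'` is `ξ` times the coboundary of `(η, b)`.

Conversely, suppose that an isomorphism `(f, F)` and such a pair `(η, b)` are given. Regrading along
`F` leaves vector spaces and linear maps unchanged and is an equivalence of categories. The scalars
`η` and `b` make it a crossed functor, and the same four identities, read backwards, are its axioms
(`Comparison.crossedFunctor`). The cochains need not be normalized: the unit structure is fixed by
the value `η(1,1)`, and its compatibilities follow from the identities at arguments equal to `1`. -/

noncomputable section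

universe u v w

set_option linter.unusedSectionVars false

open CategoryTheory MonoidalCategory
open scoped TensorProduct

/-! ### Pure tensors, homogeneous elements and lines -/

namespace VecTw

variable {K : Type u} [Field K] {X : Type w} [Group X] [Fintype X] {ω : Cocycle3 K X}
  {U V W V' W' : VecTw ω}

/-- The pure tensor `v ⊗ w` as an element of the tensor product in `VecTw ω`. -/
def tm (v : V) (w : W) : (V ⊗ W : VecTw ω) := v ⊗ₜ[K] w

theorem smul_tm (a : K) (v : V) (w : W) : tm (a • v) w = a • tm v w :=
  (TensorProduct.smul_tmul' a v w).symm

theorem tm_smul (a : K) (v : V) (w : W) : tm v (a • w) = a • tm v w :=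
  TensorProduct.tmul_smul a v w

/-- Choose functionals `l`, `m` with `l v ≠ 0` and `m w ≠ 0`; then `l ⊗ m` takes the nonzero value
`l v * m w`. This allows scalars in front of a pure tensor of generators to be compared. -/
theorem tm_ne_zero {v : V} {w : W} (hv : v ≠ 0) (hw : w ≠ 0) : tm v w ≠ 0 :=
  fun h => by
    have hl := mt (Module.forall_dual_apply_eq_zero_iff K v).1 hv
    have hm := mt (Module.forall_dual_apply_eq_zero_iff K w).1 hw
    push Not at hl hm
    obtain ⟨l, hl⟩ := hl
    obtain ⟨m, hm⟩ := hm
    refine mul_ne_zero hl hm ?_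
    have : LinearMap.mul' K K (TensorProduct.map l m (v ⊗ₜ[K] w)) = 0 :=
      (congrArg (fun t => LinearMap.mul' K K (TensorProduct.map l m t)) h).trans (by simp)
    simpa using this

theorem IsDeg.tm {x y : X} {v : V} {w : W} (hv : V.IsDeg x v) (hw : W.IsDeg y w) :
    (V ⊗ W : VecTw ω).IsDeg (x * y) (tm v w) := isDeg_tmul hv hw

@[simp] theorem lin_whiskerRight_tm (f : V ⟶ V') (v : V) (w : W) :
    lin (f ▷ W) (tm v w) = tm (lin f v) w := rfl

@[simp] theorem lin_whiskerLeft_tm (f : W ⟶ W') (v : V) (w : W) :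
    lin (V ◁ f) (tm v w) = tm v (lin f w) := rfl

@[simp] theorem lin_tensorHom_tm (f : V ⟶ V') (g : W ⟶ W') (v : V) (w : W) :
    lin (f ⊗ₘ g) (tm v w) = tm (lin f v) (lin g w) := rfl

theorem lin_associator_tm {x y z : X} {u : U} {v : V} {w : W} (hu : U.IsDeg x u)
    (hv : V.IsDeg y v) (hw : W.IsDeg z w) :
    lin (α_ U V W).hom (tm (tm u v) w) = (ω.1 x y z : K) • tm u (tm v w) :=
  assocLin_apply hu hv hw

/-- Distinct homogeneous components meet only in zero. All statements about the degrees of images of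
lines are obtained by finding two degrees for one nonzero vector. -/
theorem IsDeg.eq {x y : X} {v : V} (hx : V.IsDeg x v) (hy : V.IsDeg y v) (hv : v ≠ 0) :
    x = y := by
  by_contra h
  exact hv (hy.symm.trans (hx.proj_ne (Ne.symm h)))

theorem lin_injective_of_isIso (f : V ⟶ W) [IsIso f] : Function.Injective (lin f) := by
  intro v w h
  have := congrArg (lin (inv f)) h
  simpa only [← lin_comp, IsIso.hom_inv_id, lin_id] using this

theorem lin_ne_zero_of_isIso (f : V ⟶ W) [IsIso f] {v : V} (hv : v ≠ 0) : lin f v ≠ 0 :=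
  fun h => hv (lin_injective_of_isIso f (h.trans (map_zero _).symm))

open Classical in
/-- The field `K` in degree `x`. -/
def line (ω : Cocycle3 K X) (x : X) : VecTw ω where
  carrier := K
  proj y := if y = x then 1 else 0
  isProj := by
    rw [CompleteOrthogonalIdempotents.iff_ortho_complete]
    constructor
    · intro y z h
      by_cases e : y = x
      · simp [e]; rintro rfl; exact absurd e h
      · simp [e]
    · simp

/-- The generator of `line ω x`. -/
def gen (ω : Cocycle3 K X) (x : X) : line ω x := (1 : K)

theorem gen_ne_zero (x : X) : gen ω x ≠ 0 := one_ne_zero (α := K)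

theorem isDeg_line (x : X) (v : line ω x) : (line ω x).IsDeg x v := by
  classical
  change (if x = x then (1 : Module.End K K) else 0) v = v
  rw [if_pos rfl]; rfl

theorem eq_smul_gen {x : X} (v : line ω x) : ∃ a : K, v = a • gen ω x :=
  ⟨v, (mul_one (M := K) v).symm⟩

/-- A line is spanned by its generator. Identities between structure maps that start at a line thus
reduce to the evaluation of a single vector. -/
theorem line_hom_ext {x : X} {f g : line ω x ⟶ V} (h : lin f (gen ω x) = lin g (gen ω x)) :
    f = g :=
  hom_ext fun _ v _ => by
    obtain ⟨a, rfl⟩ := eq_smul_gen v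
    rw [map_smul, map_smul, h]

/-- The morphism `line ω x ⟶ V` given by an element of `V` of degree `x`. -/
def lineHom {x : X} (v : V) (hv : V.IsDeg x v) : line ω x ⟶ V :=
  mkHom (V := line ω x) (LinearMap.toSpanSingleton K V v) fun y a ha => by
    by_cases e : x = y
    · subst e
      exact hv.smul (show K from a)
    · have h : a = 0 := by
        by_contra h
        exact e ((isDeg_line x a).eq ha h)
      rw [h]
      exact (congrArg _ (map_zero (LinearMap.toSpanSingleton K V v))).trans
        ((map_zero _).trans (map_zero (LinearMap.toSpanSingleton K V v)).symm)

@[simp] theorem lineHom_gen {x : X} (v : V) (hv : V.IsDeg x v) :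
    lin (lineHom v hv) (gen ω x) = v := one_smul K v

/-- The canonical morphism `line (x y) ⟶ line x ⊗ line y`. -/
def lineTensor (ω : Cocycle3 K X) {x y z : X} (h : z = x * y) : line ω z ⟶ line ω x ⊗ line ω y :=
  lineHom (tm (gen ω x) (gen ω y)) (h ▸ (isDeg_line x _).tm (isDeg_line y _))

theorem end_line {x : X} (f : line ω x ⟶ line ω x) : ∃ a : K, f = a • 𝟙 _ := by
  obtain ⟨a, ha⟩ := eq_smul_gen (lin f (gen ω x))
  exact ⟨a, line_hom_ext ha⟩

theorem lin_ne_zero {f : V ⟶ W} (h : f ≠ 0) : ∃ x v, V.IsDeg x v ∧ lin f v ≠ 0 := by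
  by_contra! h'
  exact h (hom_ext h')

/-- An object all of whose endomorphisms are scalars is one-dimensional and homogeneous. -/
theorem exists_homogeneous_generator (h0 : 𝟙 V ≠ 0) (h : ∀ f : V ⟶ V, ∃ a : K, f = a • 𝟙 V) :
    ∃ (x : X) (e : V), V.IsDeg x e ∧ e ≠ 0 ∧ ∀ v : V, ∃ a : K, v = a • e := by
  -- Since the identity is nonzero, some component `V_x` contains a nonzero vector `e`.
  obtain ⟨x, e, he, hne⟩ := lin_ne_zero h0
  rw [lin_id] at hne
  -- The projection onto `V_x` is an endomorphism, hence a scalar. It fixes `e`, so the scalar is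
  -- `1` and `V` is concentrated in degree `x`.
  obtain ⟨a, ha⟩ := h (mkHom (V.proj x) fun y v hv => by
    by_cases exy : x = y
    · subst exy; exact V.isDeg_proj _ _
    · rw [hv.proj_ne exy]; exact map_zero _)
  have hax : ∀ v, V.proj x v = a • v := fun v =>
    LinearMap.congr_fun (congrArg (fun f : V ⟶ V => lin f) ha) v
  have ha1 : a = 1 := by
    have h1 : (a - 1) • e = 0 := by
      rw [sub_smul, one_smul, ← hax, he, sub_self]
    exact sub_eq_zero.1 ((smul_eq_zero.1 h1).resolve_right hne)
  have hdeg : ∀ v, V.IsDeg x v := fun v => by rw [IsDeg, hax, ha1, one_smul]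
  refine ⟨x, e, he, hne, fun v => ?_⟩
  obtain ⟨l, hl⟩ := not_forall.1 (mt (Module.forall_dual_apply_eq_zero_iff K e).1 hne)
  -- With `V` in a single degree, every linear endomorphism preserves the grading. The rank-one map
  -- `w ↦ l w • v` is therefore a scalar `b`, and its value at `e` exhibits `v` as a multiple of
  -- `e`.
  obtain ⟨b, hb⟩ := h (mkHom (LinearMap.smulRight l v) fun y w hw => by
    by_cases exy : x = y
    · subst exy; exact hdeg _
    · have : w = 0 := by
        by_contra hw0
        exact exy ((hdeg w).eq hw hw0)
      rw [this, map_zero]; exact map_zero _)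
  have hb' : l e • v = b • e :=
    LinearMap.congr_fun (congrArg (fun f : V ⟶ V => lin f) hb) e
  exact ⟨(l e)⁻¹ * b, by rw [mul_smul, ← hb', inv_smul_smul₀ hl]⟩

end VecTw

/-! ### Linear and monoidal functors on lines -/

namespace VecTw

open Functor.OplaxMonoidal

variable {K : Type u} [Field K] {X : Type w} [Group X] [Fintype X] {ω : Cocycle3 K X}
  {X' : Type*} [Group X'] [Fintype X'] {ω' : Cocycle3 K X'}
  (F : VecTw ω ⥤ VecTw ω') {U V W V' W' : VecTw ω}

theorem lin_map_comp (f : U ⟶ V) (g : V ⟶ W) (t : F.obj U) :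
    lin (F.map (f ≫ g)) t = lin (F.map g) (lin (F.map f) t) := by
  rw [F.map_comp, lin_comp]

theorem lin_map_smul [F.Additive] [F.Linear K] (a : K) (f : U ⟶ V) (t : F.obj U) :
    lin (F.map (a • f)) t = a • lin (F.map f) t := by
  rw [F.map_smul, lin_smul]

section Monoidal

variable [F.Monoidal]

/-- This is naturality of the tensor structure in elementwise form, so that it can move scalars and
structure maps past `δ` when a vector is followed through a diagram. -/
theorem lin_δ_whiskerRight (f : V ⟶ V') (t : F.obj (V ⊗ W)) :
    lin (δ F V' W) (lin (F.map (f ▷ W)) t) = lin (F.map f ▷ F.obj W) (lin (δ F V W) t) := by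
  rw [← lin_comp, ← lin_comp, δ_natural_left]

theorem lin_δ_whiskerLeft (f : W ⟶ W') (t : F.obj (V ⊗ W)) :
    lin (δ F V W') (lin (F.map (V ◁ f)) t) = lin (F.obj V ◁ F.map f) (lin (δ F V W) t) := by
  rw [← lin_comp, ← lin_comp, δ_natural_right]

theorem lin_δ_tensorHom (f : V ⟶ V') (g : W ⟶ W') (t : F.obj (V ⊗ W)) :
    lin (δ F V' W') (lin (F.map (f ⊗ₘ g)) t) =
      lin (F.map f ⊗ₘ F.map g) (lin (δ F V W) t) := by
  rw [← lin_comp, ← lin_comp, δ_natural]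

/-- This is the coherence of a tensor functor with the associators, at one vector. On lines it is
the source of the relation between `ω` and `ω'`. -/
theorem lin_δ_associator (t : F.obj ((U ⊗ V) ⊗ W)) :
    lin (α_ (F.obj U) (F.obj V) (F.obj W)).hom
        (lin (δ F U V ▷ F.obj W) (lin (δ F (U ⊗ V) W) t)) =
      lin (F.obj U ◁ δ F V W) (lin (δ F U (V ⊗ W)) (lin (F.map (α_ U V W).hom) t)) := by
  simp only [← lin_comp]
  rw [Category.assoc, Category.assoc, Functor.OplaxMonoidal.associativity]

end Monoidal

/-- `e x` is a homogeneous generator of degree `d x` of the image of the line in degree `x`. -/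
structure LineImage (d : X → X') (e : ∀ x, F.obj (line ω x)) : Prop where
  isDeg : ∀ x, (F.obj (line ω x)).IsDeg (d x) (e x)
  ne_zero : ∀ x, e x ≠ 0
  span : ∀ x (v : F.obj (line ω x)), ∃ a : K, v = a • e x

/-- The vector `e x` spans the image of the line, so a morphism out of that image that kills `e x`
is zero. Faithfulness would then force `lineHom v hv` to be zero, although it sends the generator to
`v`. -/
theorem LineImage.map_ne_zero [F.Additive] [F.Faithful] {d : X → X'}
    {e : ∀ x, F.obj (line ω x)} (h : LineImage F d e) {x : X} {v : V} (hv : V.IsDeg x v)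
    (h0 : v ≠ 0) : lin (F.map (lineHom v hv)) (e x) ≠ 0 := by
  intro h1
  have : F.map (lineHom v hv) = F.map 0 := by
    rw [F.map_zero]
    refine hom_ext fun y w _ => ?_
    obtain ⟨a, rfl⟩ := h.span x w
    rw [map_smul, h1, smul_zero, lin_zero]
  have h2 := congrArg (fun f : line ω x ⟶ V => lin f (gen ω x)) (F.map_injective this)
  exact h0 (by simpa using h2)

/-- An equivalence preserves the property that all endomorphisms are scalars, which characterizes
lines. Injectivity of `d` comes from fullness and surjectivity from essential surjectivity. -/
theorem exists_lineImage [F.Additive] [F.Linear K] [F.IsEquivalence] :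
    ∃ (d : X → X') (e : ∀ x, F.obj (line ω x)), Function.Bijective d ∧ LineImage F d e := by
  have key : ∀ x, ∃ (y : X') (e : F.obj (line ω x)), (F.obj (line ω x)).IsDeg y e ∧ e ≠ 0 ∧
      ∀ v, ∃ a : K, v = a • e := fun x => by
    refine exists_homogeneous_generator (fun h => ?_) fun f => ?_
    · rw [← F.map_id, ← F.map_zero] at h
      have h2 := congrArg (fun f : line ω x ⟶ line ω x => lin f (gen ω x)) (F.map_injective h)
      exact gen_ne_zero x (by simpa using h2)
    · obtain ⟨a, ha⟩ := end_line (F.preimage f)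
      exact ⟨a, by rw [← F.map_preimage f, ha, F.map_smul, F.map_id]⟩
  choose d e hd hne hspan using key
  have hL : LineImage F d e := ⟨hd, hne, hspan⟩
  refine ⟨d, e, ⟨fun x y hxy => ?_, fun y => ?_⟩, hL⟩
  · obtain ⟨l, hl⟩ := not_forall.1 (mt (Module.forall_dual_apply_eq_zero_iff K (e x)).1 (hne x))
    -- If `d x = d y`, a nonzero linear map between the two images preserves degrees. It lifts along
    -- `F` to a nonzero morphism between the lines in degrees `x` and `y`, which forces `x = y`.
    let f : F.obj (line ω x) ⟶ F.obj (line ω y) := mkHom (LinearMap.smulRight l (e y))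
      fun z v hv => by
        obtain ⟨a, rfl⟩ := hspan x v
        by_cases ha : a • e x = 0
        · rw [ha, map_zero]; exact map_zero _
        · have : z = d x := hv.eq ((hd x).smul a) ha
          rw [this, hxy]
          exact (hd y).smul _
    have hf : lin f (e x) ≠ 0 := smul_ne_zero hl (hne y)
    have h0 : lin (F.preimage f) (gen ω x) ≠ 0 := fun h => by
      have : F.preimage f = 0 := line_hom_ext h
      rw [← F.map_preimage f, this, F.map_zero] at hf
      exact hf rfl
    exact ((isDeg_line x (gen ω x)).lin (F.preimage f)).eq (isDeg_line y _) h0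
  · let V := F.objPreimage (line ω' y)
    let i : F.obj V ≅ line ω' y := F.objObjPreimageIso (line ω' y)
    -- The object `V` is nonzero because its image is isomorphic to a line.
    obtain ⟨x, v, hv, h0⟩ : ∃ x v, V.IsDeg x v ∧ v ≠ 0 := by
      have : 𝟙 V ≠ 0 := fun h => by
        have h1 : 𝟙 (F.obj V) = 0 := by rw [← F.map_id, h, F.map_zero]
        have h2 := congrArg (fun f => lin (i.inv ≫ f ≫ i.hom) (gen ω' y)) h1
        simp only [Category.id_comp, i.inv_hom_id, Limits.zero_comp, Limits.comp_zero] at h2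
        exact gen_ne_zero y h2
      simpa using lin_ne_zero this
    refine ⟨x, ?_⟩
    -- The inclusion of the line through `v` carries `e x`, of degree `d x`, to a nonzero vector of
    -- `F.obj V`. Under `i` this lands in the line of degree `y`, hence `d x = y`.
    have h1 := lin_ne_zero_of_isIso i.hom (hL.map_ne_zero F hv h0)
    exact (((hd x).lin _).lin i.hom).eq (isDeg_line y _) h1

end VecTw

/-! ### The structure maps of the crossed pointed category on homogeneous vectors -/

namespace CrossedPointed

open VecTw Functor.OplaxMonoidal

variable {K : Type u} [Field K] {G : Type v} {X : Type w} [Group G] [Finite G] [Group X]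
  [Fintype X] {𝒳 : CrossedModule G X} {ξ : Z3qa K 𝒳} {V W : VecTw (omega ξ)}

/-- An element `v` of `V` as an element of `T_g V`. -/
def inT (g : G) (v : V) : ((crossedPointed ξ).T g).obj V := v

theorem inT_smul (g : G) (a : K) (v : V) : inT g (a • v) = a • inT g v := rfl

theorem isDeg_inT (g : G) {x : X} {v : V} (hv : V.IsDeg x v) :
    (((crossedPointed ξ).T g).obj V).IsDeg (𝒳.act g x) (inT g v) := isDeg_tObj g hv

theorem inT_ne_zero (g : G) {v : V} (hv : v ≠ 0) : inT g v ≠ 0 := hv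

theorem lin_T_map (g : G) (f : V ⟶ W) (v : V) :
    lin (((crossedPointed ξ).T g).map f) (inT g v) = inT g (lin f v) := rfl

/-- `T_g` was made monoidal from the isomorphism with scalar `μ⁻¹`, and `δ` is its inverse. The
scalar here is therefore `μ` itself. -/
theorem lin_T_δ (g : G) {x y : X} {v : V} {w : W} (hv : V.IsDeg x v) (hw : W.IsDeg y w) :
    lin (δ ((crossedPointed ξ).T g) V W) (inT g (tm v w)) =
      (mu ξ g x y : K) • tm (inT g v) (inT g w) :=
  scal₂_apply _ hv hw

variable (ξ) in
/-- The component `T_{gh} V ⟶ T_g (T_h V)` of the action constraint. -/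
def γApp (g h : G) (V : VecTw (omega ξ)) : ((crossedPointed ξ).T (g * h)).obj V ⟶
    ((crossedPointed ξ).T g).obj (((crossedPointed ξ).T h).obj V) :=
  ((crossedPointed ξ).γ g h).hom.app V

theorem lin_γApp (g h : G) {x : X} {v : V} (hv : V.IsDeg x v) :
    lin (γApp ξ g h V) (inT (g * h) v) =
      (gamma ξ g h x : K) • inT g (inT h v) :=
  scal₁_apply _ hv

theorem lin_braid {g : G} (hV : (crossedPointed ξ).grade g V) {x y : X} {v : V} {w : W}
    (hv : V.IsDeg x v) (hw : W.IsDeg y w) :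
    lin ((crossedPointed ξ).braid hV W).hom (tm v w) = (cc ξ x y : K) • tm (inT g w) v :=
  tBraid_apply hV hv hw

/-- The functors `T_g` all keep the underlying space, so the identifications along equalities in the
group contribute no scalar. -/
theorem lin_transport_T {g h : G} (e : g = h) (v : V) :
    lin ((transport (crossedPointed ξ).T e).app V) (inT g v) = inT h v := by
  subst e; rfl

theorem grade_line (x : X) : (crossedPointed ξ).grade (𝒳.bd x) (line (omega ξ) x) :=
  tGrade_iff.2 fun y v hv hy => by
    by_contra h
    exact hy (by rw [hv.eq (isDeg_line x v) h])

variable (ξ) in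
/-- The canonical morphism `line (ᵍx) ⟶ T_g (line x)`. -/
def lineT (g : G) {x y : X} (h : y = 𝒳.act g x) :
    line (omega ξ) y ⟶ ((crossedPointed ξ).T g).obj (line (omega ξ) x) :=
  lineHom (inT g (gen _ x)) (h ▸ isDeg_inT g (isDeg_line x _))

end CrossedPointed

/-! ### Cocycle values as structure constants between lines -/

namespace VecTw

variable {K : Type u} [Field K] {X : Type w} [Group X] [Fintype X] {ω : Cocycle3 K X}
  {V W : VecTw ω}

/-- A tensor product of spaces spanned by single vectors is spanned by their tensor. The multiple is
a unit because `t` is nonzero. -/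
theorem exists_eq_smul_tm {v : V} {w : W} (hv : ∀ v' : V, ∃ a : K, v' = a • v)
    (hw : ∀ w' : W, ∃ a : K, w' = a • w) {t : (V ⊗ W : VecTw ω)} (ht : t ≠ 0) :
    ∃ a : Kˣ, t = (a : K) • tm v w := by
  have key : ∀ t : V ⊗[K] W, ∃ a : K, t = a • (v ⊗ₜ[K] w) := fun t => by
    induction t with
    | zero => exact ⟨0, (zero_smul _ _).symm⟩
    | tmul v' w' =>
      obtain ⟨a, rfl⟩ := hv v'
      obtain ⟨b, rfl⟩ := hw w'
      exact ⟨a * b, by rw [TensorProduct.tmul_smul, ← TensorProduct.smul_tmul', smul_smul, mul_comm]⟩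
    | add s t hs ht =>
      obtain ⟨a, rfl⟩ := hs
      obtain ⟨b, rfl⟩ := ht
      exact ⟨a + b, (add_smul _ _ _).symm⟩
  obtain ⟨a, ha⟩ := key t
  have ha0 : a ≠ 0 := by
    rintro rfl
    exact ht (ha.trans (zero_smul _ _))
  exact ⟨Units.mk0 a ha0, ha⟩

theorem exists_eq_smul {v : V} (hv : ∀ v' : V, ∃ a : K, v' = a • v) {t : V} (ht : t ≠ 0) :
    ∃ a : Kˣ, t = (a : K) • v := by
  obtain ⟨a, ha⟩ := hv t
  have ha0 : a ≠ 0 := by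
    rintro rfl
    exact ht (ha.trans (zero_smul _ _))
  exact ⟨Units.mk0 a ha0, ha⟩

@[simp] theorem lineTensor_gen {x y z : X} (h : z = x * y) :
    lin (lineTensor ω h) (gen ω z) = tm (gen ω x) (gen ω y) := lineHom_gen _ _

/-- The two bracketings `(x * y) * z` and `x * (y * z)` give equal but syntactically different
lines. Keeping the equalities of degrees as hypotheses lets both composites start at the same line
`line ω p`, without casts between objects. -/
theorem lineTensor_assoc {x y z p q r : X} (h₁ : p = q * z) (h₂ : q = x * y) (h₃ : p = x * r)
    (h₄ : r = y * z) :
    lineTensor ω h₁ ≫ lineTensor ω h₂ ▷ line ω z ≫ (α_ _ _ _).hom =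
      (ω.1 x y z : K) • (lineTensor ω h₃ ≫ line ω x ◁ lineTensor ω h₄) := by
  apply line_hom_ext
  rw [lin_smul]
  simp only [lin_comp, lineTensor_gen, lin_whiskerRight_tm, lin_whiskerLeft_tm]
  exact lin_associator_tm (isDeg_line x _) (isDeg_line y _) (isDeg_line z _)

end VecTw

namespace CrossedPointed

open VecTw Functor.OplaxMonoidal

section Lines

variable {K : Type u} [Field K] {G : Type v} {X : Type w} [Group G] [Finite G] [Group X]
  [Fintype X] {𝒳 : CrossedModule G X} {ξ : Z3qa K 𝒳}

@[simp] theorem lineT_gen (g : G) {x y : X} (h : y = 𝒳.act g x) :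
    lin (lineT ξ g h) (gen _ y) = inT g (gen _ x) := lineHom_gen _ _

theorem lineT_δ (g : G) {x y z x' y' z' : X} (hx : x' = 𝒳.act g x) (hy : y' = 𝒳.act g y)
    (hz : z' = 𝒳.act g z) (h : z = x * y) (h' : z' = x' * y') :
    lineT ξ g hz ≫ ((crossedPointed ξ).T g).map (lineTensor _ h) ≫
        δ ((crossedPointed ξ).T g) _ _ =
      (mu ξ g x y : K) • (lineTensor _ h' ≫ (lineT ξ g hx ⊗ₘ lineT ξ g hy)) := by
  apply line_hom_ext
  rw [lin_smul]
  simp only [lin_comp, lineTensor_gen, lineT_gen, lin_T_map, lin_tensorHom_tm]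
  exact lin_T_δ g (isDeg_line x _) (isDeg_line y _)

theorem lineT_γ (g h : G) {x y z : X} (h₁ : z = 𝒳.act (g * h) x) (h₂ : z = 𝒳.act g y)
    (h₃ : y = 𝒳.act h x) :
    lineT ξ (g * h) h₁ ≫ γApp ξ g h _ =
      (gamma ξ g h x : K) • (lineT ξ g h₂ ≫ ((crossedPointed ξ).T g).map (lineT ξ h h₃)) := by
  apply line_hom_ext
  rw [lin_smul]
  simp only [lin_comp, lineT_gen, lin_T_map]
  exact lin_γApp g h (isDeg_line x _)

/-- The product `x * y` also factors as `t * x`, where `t` is the degree acquired by the second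
factor when it passes the first. Both sides thus start at one line and differ by `c(x,y)`. -/
theorem lineTensor_braid {x y z t : X} (h₁ : z = x * y) (h₂ : z = t * x)
    (h₃ : t = 𝒳.act (𝒳.bd x) y) :
    lineTensor _ h₁ ≫ ((crossedPointed ξ).braid (grade_line x) (line _ y)).hom =
      (cc ξ x y : K) • (lineTensor _ h₂ ≫ lineT ξ (𝒳.bd x) h₃ ▷ line _ x) := by
  apply line_hom_ext
  rw [lin_smul]
  simp only [lin_comp, lineTensor_gen, lineT_gen, lin_whiskerRight_tm]
  exact lin_braid (grade_line x) (isDeg_line x _) (isDeg_line y _)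

end Lines

/-! ### From a crossed equivalence to cohomologous cocycles -/

section CrossedFunctor

variable {K : Type u} [Field K]
  {G X G' X' : Type*} [Group G] [Finite G] [Group X] [Fintype X]
  [Group G'] [Finite G'] [Group X'] [Fintype X']
  {𝒳 : CrossedModule G X} {𝒳' : CrossedModule G' X'} {ξ : Z3qa K 𝒳} {ξ' : Z3qa K 𝒳'}
  (Φ : CrossedFunctor (crossedPointed ξ) (crossedPointed ξ'))

attribute [local instance] CrossedFunctor.F_additive CrossedFunctor.F_linear
  CrossedFunctor.F_monoidal

/-- The component `F (T_g V) ⟶ T'_{f(g)} (F V)` of the structure `β` of a crossed functor. -/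
def βApp (g : G) (V : VecTw (omega ξ)) : Φ.F.obj (((crossedPointed ξ).T g).obj V) ⟶
    ((crossedPointed ξ').T (Φ.f g)).obj (Φ.F.obj V) :=
  (Φ.β g).hom.app V

instance (g : G) (V : VecTw (omega ξ)) : IsIso (βApp Φ g V) :=
  inferInstanceAs (IsIso ((Φ.β g).hom.app V))

theorem lin_βApp_map (g : G) {V W : VecTw (omega ξ)} (f : V ⟶ W)
    (t : Φ.F.obj (((crossedPointed ξ).T g).obj V)) :
    lin (βApp Φ g W) (lin (Φ.F.map (((crossedPointed ξ).T g).map f)) t) =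
      lin (((crossedPointed ξ').T (Φ.f g)).map (Φ.F.map f)) (lin (βApp Φ g V) t) :=
  congrArg (fun f => lin f t) ((Φ.β g).hom.naturality f)

/-- This is monoidality of `β_g`, put in terms of `δ`, the direction in which the scalars `η` and
`μ` occur without inverses. -/
theorem lin_βApp_δ (g : G) (V W : VecTw (omega ξ))
    (t : Φ.F.obj (((crossedPointed ξ).T g).obj (V ⊗ W))) :
    lin (δ ((crossedPointed ξ').T (Φ.f g)) _ _)
        (lin (((crossedPointed ξ').T (Φ.f g)).map (δ Φ.F V W)) (lin (βApp Φ g (V ⊗ W)) t)) =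
      lin (βApp Φ g V ⊗ₘ βApp Φ g W)
        (lin (δ Φ.F _ _) (lin (Φ.F.map (δ ((crossedPointed ξ).T g) V W)) t)) := by
  have h := (Φ.β_monoidal g).tensor V W
  -- Monoidality of a transformation is formulated with the inverses of the maps `δ`. Composition
  -- with `δ` on both sides cancels them.
  have h2 := congrArg (fun f => δ ((crossedPointed ξ).T g ⋙ Φ.F) V W ≫ f ≫
    δ (Φ.F ⋙ (crossedPointed ξ').T (Φ.f g)) V W) h
  simp only [Category.assoc, Functor.Monoidal.δ_μ_assoc, Functor.Monoidal.μ_δ,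
    Category.comp_id] at h2
  rw [comp_δ, comp_δ] at h2
  simp only [Category.assoc] at h2
  exact congrArg (fun f => lin f t) h2

theorem lin_βApp_γApp (g h : G) (V : VecTw (omega ξ))
    (t : Φ.F.obj (((crossedPointed ξ).T (g * h)).obj V)) :
    lin (((crossedPointed ξ').T (Φ.f g)).map (βApp Φ h V))
        (lin (βApp Φ g _) (lin (Φ.F.map (γApp ξ g h V)) t)) =
      lin (γApp ξ' (Φ.f g) (Φ.f h) _)
        (lin ((transport (crossedPointed ξ').T (map_mul Φ.f g h)).app (Φ.F.obj V))
          (lin (βApp Φ (g * h) V) t)) :=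
  congrArg (fun f => lin f t) (Φ.map_γ g h V)

theorem lin_βApp_braid {g : G} {V : VecTw (omega ξ)} (hV : (crossedPointed ξ).grade g V)
    (W : VecTw (omega ξ)) (t : Φ.F.obj (V ⊗ W)) :
    lin (βApp Φ g W ▷ Φ.F.obj V)
        (lin (δ Φ.F _ _) (lin (Φ.F.map ((crossedPointed ξ).braid hV W).hom) t)) =
      lin ((crossedPointed ξ').braid (Φ.map_grade hV) (Φ.F.obj W)).hom (lin (δ Φ.F V W) t) :=
  congrArg (fun f => lin f t) (Φ.map_braid hV W)

/-- The matrix coefficients `η`, `β` of a crossed functor, with respect to generators `e` of the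
images of the lines. -/
structure Coefficients (d : X → X') (e : ∀ x, Φ.F.obj (line (omega ξ) x))
    (η : X → X → Kˣ) (b : G → X → Kˣ) : Prop where
  image : LineImage Φ.F d e
  δ_eq : ∀ {x y z : X} (h : z = x * y),
    lin (δ Φ.F _ _) (lin (Φ.F.map (lineTensor _ h)) (e z)) = (η x y : K) • tm (e x) (e y)
  β_eq : ∀ (g : G) {x y : X} (h : y = 𝒳.act g x),
    lin (βApp Φ g _) (lin (Φ.F.map (lineT ξ g h)) (e y)) =
      (b g x : K) • inT (Φ.f g) (e x)

variable {Φ}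

/-- Each target is spanned by one vector, the tensor or the translate of generators. The
coefficients are nonzero because `F` is faithful on maps out of lines and because `δ` and `β` are
invertible. -/
theorem exists_coefficients [Φ.F.IsEquivalence] {d : X → X'}
    {e : ∀ x, Φ.F.obj (line (omega ξ) x)} (h : LineImage Φ.F d e) :
    ∃ η b, Coefficients Φ d e η b := by
  have h1 : ∀ x y : X, ∃ a : Kˣ, lin (δ Φ.F _ _) (lin (Φ.F.map (lineTensor _ rfl)) (e (x * y))) =
      (a : K) • tm (e x) (e y) := fun x y =>
    exists_eq_smul_tm (h.span x) (h.span y) <| lin_ne_zero_of_isIso _ <|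
      h.map_ne_zero _ _ (tm_ne_zero (gen_ne_zero x) (gen_ne_zero y))
  have h2 : ∀ (g : G) (x : X), ∃ a : Kˣ,
      lin (βApp Φ g _) (lin (Φ.F.map (lineT ξ g rfl)) (e (𝒳.act g x))) =
        (a : K) • inT (Φ.f g) (e x) := fun g x =>
    -- `T'_{f(g)}` does not change the underlying space, so `e x` still spans it.
    exists_eq_smul (V := ((crossedPointed ξ').T (Φ.f g)).obj _) (h.span x) <|
      lin_ne_zero_of_isIso _ <| h.map_ne_zero _ _ (inT_ne_zero g (gen_ne_zero x))
  choose η hη using h1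
  choose b hb using h2
  refine ⟨η, b, h, ?_, ?_⟩
  · rintro x y z rfl; exact hη x y
  · rintro g x y rfl; exact hb g x

namespace Coefficients

variable {d : X → X'} {e : ∀ x, Φ.F.obj (line (omega ξ) x)} {η : X → X → Kˣ} {b : G → X → Kˣ}
  (h : Coefficients Φ d e η b)

include h

/-- The vector in `δ_eq` has degree `d (x * y)`, being the image of `e (x * y)` under morphisms. It
is also a nonzero multiple of `e x ⊗ e y`, which has degree `d x * d y`. -/
theorem deg_mul (x y : X) : d (x * y) = d x * d y := by
  have h1 := h.δ_eq (x := x) (y := y) rfl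
  have h2 := ((h.image.isDeg x).tm (h.image.isDeg y)).smul (η x y : K)
  have h3 := ((h.image.isDeg (x * y)).lin (Φ.F.map (lineTensor _ rfl))).lin (δ Φ.F _ _)
  refine h3.eq (h1 ▸ h2) ?_
  rw [h1]
  exact smul_ne_zero (η x y).ne_zero (tm_ne_zero (h.image.ne_zero x) (h.image.ne_zero y))

/-- Here the two degrees are those of the vector in `β_eq`: it is the image of the generator over
`ᵍx` and a nonzero multiple of `e x` viewed in the translate by `f g`. -/
theorem deg_act (g : G) (x : X) : d (𝒳.act g x) = 𝒳'.act (Φ.f g) (d x) := by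
  have h1 := h.β_eq g (x := x) rfl
  have h2 := (isDeg_inT (Φ.f g) (h.image.isDeg x)).smul (b g x : K)
  have h3 := ((h.image.isDeg (𝒳.act g x)).lin (Φ.F.map (lineT ξ g rfl))).lin (βApp Φ g _)
  refine h3.eq (h1 ▸ h2) ?_
  rw [h1]
  exact smul_ne_zero (b g x).ne_zero (inT_ne_zero (Φ.f g) (h.image.ne_zero x))

/-- A crossed functor respects the gradings, so the image of the line in degree `x` is supported
over `f (∂ x)`. It contains the nonzero vector `e x` of degree `d x`. -/
theorem deg_bd (x : X) : 𝒳'.bd (d x) = Φ.f (𝒳.bd x) :=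
  (bd_eq_or (Φ.map_grade (grade_line x)) (h.image.isDeg x)).resolve_right (h.image.ne_zero x)

/-- Compatibility of `F` with the associators is evaluated at `e (x * y * z)`. Both sides are
multiples of `e x ⊗ (e y ⊗ e z)`: one path collects `η(xy,z) η(x,y)` and then `ω'`, the other `ω`
and then `η(x,yz) η(y,z)`. -/
theorem omega_eq (x y z : X) : ((omega ξ').1 (d x) (d y) (d z) : K) * (η (x * y) z * η x y) =
    (omega ξ).1 x y z * (η y z * η x (y * z)) := by
  -- The identity between maps of lines is pushed through `F` and evaluated at the generator; this
  -- is how the value of `ω` enters.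
  have h1 := congrArg (fun f => lin (Φ.F.map f) (e (x * y * z)))
    (lineTensor_assoc (ω := omega ξ) (x := x) (y := y) (z := z) rfl rfl (mul_assoc x y z) rfl)
  simp only [lin_map_comp, lin_map_smul] at h1
  have h2 := lin_δ_associator Φ.F
    (lin (Φ.F.map (lineTensor _ rfl ▷ line _ z)) (lin (Φ.F.map (lineTensor _ rfl)) (e (x * y * z))))
  rw [h1, map_smul, map_smul, lin_δ_whiskerRight, lin_δ_whiskerLeft, h.δ_eq, h.δ_eq] at h2
  simp only [map_smul, lin_whiskerRight_tm, lin_whiskerLeft_tm, h.δ_eq, smul_tm, tm_smul] at h2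
  rw [lin_associator_tm (h.image.isDeg x) (h.image.isDeg y) (h.image.isDeg z)] at h2
  simp only [smul_smul] at h2
  -- The common pure tensor is nonzero, so the scalars agree.
  have h3 := smul_left_injective K (tm_ne_zero (h.image.ne_zero x)
    (tm_ne_zero (h.image.ne_zero y) (h.image.ne_zero z))) h2
  linear_combination h3

/-- This is the compatibility of `β` with the action constraints at `e (ᵍᵏx)`. Going through `γ`
costs `γ(x)`, then `b_g(ᵏx)` and `b_k(x)`; going the other way costs `b_{gk}(x)` and then `γ'`. -/
theorem gamma_eq (g k : G) (x : X) :
    (gamma ξ' (Φ.f g) (Φ.f k) (d x) : K) * b (g * k) x =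
      gamma ξ g k x * (b g (𝒳.act k x) * b k x) := by
  have h1 := congrArg (fun f => lin (Φ.F.map f) (e (𝒳.act (g * k) x)))
    (lineT_γ (ξ := ξ) g k (x := x) rfl (by rw [map_mul, MulAut.mul_apply]) rfl)
  simp only [lin_map_comp, lin_map_smul] at h1
  have h2 := lin_βApp_γApp Φ g k (line _ x)
    (lin (Φ.F.map (lineT ξ (g * k) rfl)) (e (𝒳.act (g * k) x)))
  rw [h1, map_smul, map_smul, lin_βApp_map] at h2
  simp only [h.β_eq, map_smul, lin_T_map, inT_smul, lin_transport_T, smul_smul] at h2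
  rw [lin_γApp _ _ (h.image.isDeg x), smul_smul] at h2
  have h4 := smul_left_injective K (inT_ne_zero (Φ.f g) (inT_ne_zero (Φ.f k) (h.image.ne_zero x))) h2
  linear_combination -h4

/-- This is monoidality of `β_g` at the generator over `ᵍ(xy)`. One path applies `β_g` to the whole
product and then splits it, the other splits first and applies `β_g` to each factor. -/
theorem mu_eq (g : G) (x y : X) :
    (mu ξ' (Φ.f g) (d x) (d y) : K) * (b g (x * y) * η x y) =
      mu ξ g x y * (b g x * b g y * η (𝒳.act g x) (𝒳.act g y)) := by
  have h1 := congrArg (fun f => lin (Φ.F.map f) (e (𝒳.act g (x * y))))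
    (lineT_δ (ξ := ξ) g (x := x) (y := y) rfl rfl rfl rfl (map_mul _ _ _))
  simp only [lin_map_comp, lin_map_smul] at h1
  have h2 := lin_βApp_δ Φ g (line _ x) (line _ y)
    (lin (Φ.F.map (((crossedPointed ξ).T g).map (lineTensor _ rfl)))
      (lin (Φ.F.map (lineT ξ g rfl)) (e (𝒳.act g (x * y)))))
  rw [h1, map_smul, map_smul, lin_δ_tensorHom, h.δ_eq, lin_βApp_map] at h2
  simp only [h.β_eq, h.δ_eq, map_smul, lin_T_map, inT_smul, lin_tensorHom_tm, smul_tm, tm_smul,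
    smul_smul] at h2
  rw [lin_T_δ _ (h.image.isDeg x) (h.image.isDeg y), smul_smul] at h2
  have h4 := smul_left_injective K (tm_ne_zero (inT_ne_zero (Φ.f g) (h.image.ne_zero x))
    (inT_ne_zero (Φ.f g) (h.image.ne_zero y))) h2
  linear_combination h4

/-- This is the compatibility with the braidings at `e (x * y)`, read off on the swapped tensor of
`e y`, viewed in the translate by `f (∂ x)`, with `e x`. -/
theorem cc_eq (x y : X) :
    (cc ξ' (d x) (d y) : K) * η x y = cc ξ x y * (b (𝒳.bd x) y * η (x * y * x⁻¹) x) := by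
  have h1 := congrArg (fun f => lin (Φ.F.map f) (e (x * y)))
    -- The degree of the moved factor is written as a conjugate, not as the action of `∂ x`, so that
    -- the coefficient appears in the form `η(xyx⁻¹, x)` of the coboundary.
    (lineTensor_braid (ξ := ξ) (x := x) (y := y) (t := x * y * x⁻¹) rfl (by group)
      (𝒳.act_bd x y).symm)
  simp only [lin_map_comp, lin_map_smul] at h1
  have h2 := lin_βApp_braid Φ (grade_line x) (line _ y)
    (lin (Φ.F.map (lineTensor _ rfl)) (e (x * y)))
  rw [h1, map_smul, map_smul, lin_δ_whiskerRight, h.δ_eq, h.δ_eq] at h2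
  simp only [map_smul, lin_whiskerRight_tm, h.β_eq, smul_tm, smul_smul] at h2
  rw [lin_braid (Φ.map_grade (grade_line x)) (h.image.isDeg x) (h.image.isDeg y), smul_smul] at h2
  have h4 := smul_left_injective K (tm_ne_zero (inT_ne_zero (Φ.f (𝒳.bd x)) (h.image.ne_zero y))
    (h.image.ne_zero x)) h2
  linear_combination -h4

end Coefficients

theorem exists_iso_of_equivalence (hΦ : Φ.IsEquivalence) :
    ∃ φ : CrossedModule.Hom 𝒳 𝒳', φ.IsIso ∧ ∃ p : (X → X → Kˣ) × (G → X → Kˣ),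
      (pullback K φ ξ').1 = ξ.1 * qaCoboundary K 𝒳 p := by
  have := hΦ.2
  obtain ⟨d, e, hd, hL⟩ := exists_lineImage Φ.F
  obtain ⟨η, b, h⟩ := exists_coefficients hL
  -- The isomorphism is `(f, d)`, and the cochains are the matrix coefficients. The four components
  -- of the equality are the four scalar identities after division.
  refine ⟨⟨Φ.f, MonoidHom.mk' d h.deg_mul, h.deg_bd, h.deg_act⟩, ⟨hΦ.1, hd⟩, (η, b), ?_⟩
  refine Prod.ext ?_ (Prod.ext ?_ (Prod.ext ?_ ?_))
  · funext x y z
    refine Units.ext ?_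
    have := h.omega_eq x y z
    simp only [pullback, qaCoboundary, MonoidHom.coe_mk, OneHom.coe_mk, Prod.fst_mul,
      Pi.mul_apply, Units.val_mul, Units.val_div_eq_div_val, MonoidHom.mk'_apply]
    field_simp
    linear_combination this
  · funext g k x
    refine Units.ext ?_
    have := h.gamma_eq g k x
    simp only [pullback, qaCoboundary, MonoidHom.coe_mk, OneHom.coe_mk, Prod.fst_mul,
      Prod.snd_mul, Pi.mul_apply, Units.val_mul, Units.val_div_eq_div_val, MonoidHom.mk'_apply]
    field_simp
    linear_combination this
  · funext g x y
    refine Units.ext ?_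
    have := h.mu_eq g x y
    simp only [pullback, qaCoboundary, MonoidHom.coe_mk, OneHom.coe_mk, Prod.fst_mul,
      Prod.snd_mul, Pi.mul_apply, Units.val_mul, Units.val_div_eq_div_val, MonoidHom.mk'_apply]
    field_simp
    linear_combination this
  · funext x y
    refine Units.ext ?_
    have := h.cc_eq x y
    simp only [pullback, qaCoboundary, MonoidHom.coe_mk, OneHom.coe_mk,
      Prod.snd_mul, Pi.mul_apply, Units.val_mul, Units.val_div_eq_div_val, MonoidHom.mk'_apply]
    field_simp
    linear_combination this

end CrossedFunctor

end CrossedPointed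

/-! ### From cohomologous cocycles to a crossed equivalence -/

namespace CrossedPointed

open VecTw Functor.OplaxMonoidal

variable {K : Type u} [Field K]
  {G X G' X' : Type*} [Group G] [Finite G] [Group X] [Fintype X]
  [Group G'] [Finite G'] [Group X'] [Fintype X']
  {𝒳 : CrossedModule G X} {𝒳' : CrossedModule G' X'}

/-- An identification of the cocycle `ξ'` with `ξ`, up to the coboundary of `(η, b)`, along a
homomorphism `(f, F)` of crossed modules with `F` bijective. -/
structure Comparison (ξ : Z3qa K 𝒳) (ξ' : Z3qa K 𝒳') where
  f : G →* G'
  F : X ≃* X'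
  bd_comm : ∀ x, 𝒳'.bd (F x) = f (𝒳.bd x)
  act_comm : ∀ g x, F (𝒳.act g x) = 𝒳'.act (f g) (F x)
  η : X → X → Kˣ
  b : G → X → Kˣ
  omega_eq : ∀ x y z, ((omega ξ').1 (F x) (F y) (F z) : K) * (η (x * y) z * η x y) =
    (omega ξ).1 x y z * (η y z * η x (y * z))
  gamma_eq : ∀ g k x, (gamma ξ' (f g) (f k) (F x) : K) * b (g * k) x =
    gamma ξ g k x * (b g (𝒳.act k x) * b k x)
  mu_eq : ∀ g x y, (mu ξ' (f g) (F x) (F y) : K) * (b g (x * y) * η x y) =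
    mu ξ g x y * (b g x * b g y * η (𝒳.act g x) (𝒳.act g y))
  cc_eq : ∀ x y, (cc ξ' (F x) (F y) : K) * η x y =
    cc ξ x y * (b (𝒳.bd x) y * η (x * y * x⁻¹) x)

namespace Comparison

variable {ξ : Z3qa K 𝒳} {ξ' : Z3qa K 𝒳'} (D : Comparison ξ ξ') {U V W : VecTw (omega ξ)}

/-- The regrading functor along `F`. -/
def functor : VecTw (omega ξ) ⥤ VecTw (omega ξ') := regrade (omega ξ') D.F.toEquiv

instance : D.functor.Additive := inferInstanceAs (regrade (omega ξ') D.F.toEquiv).Additive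

instance : D.functor.Linear K := inferInstanceAs ((regrade (omega ξ') D.F.toEquiv).Linear K)

/-- The regraded object. -/
abbrev obj (V : VecTw (omega ξ)) : VecTw (omega ξ') := regradeObj (omega ξ') D.F.toEquiv V

theorem isDeg_obj {x : X} {v : V} (hv : V.IsDeg x v) : (D.obj V).IsDeg (D.F x) v :=
  isDeg_regrade D.F.toEquiv hv

theorem exists_isDeg_of_obj {x : X'} {v : V} (hv : (D.obj V).IsDeg x v) :
    ∃ y, D.F y = x ∧ V.IsDeg y v :=
  ⟨D.F.symm x, D.F.apply_symm_apply x, hv⟩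

/-- An element `v` of `V` as an element of the regraded space. -/
def inF (v : V) : D.functor.obj V := v

theorem isDeg_inF {x : X} {v : V} (hv : V.IsDeg x v) :
    (D.functor.obj V).IsDeg (D.F x) (D.inF v) := isDeg_regrade D.F.toEquiv hv

/-- A linear map preserves the grading if and only if it preserves the grading relabelled along a
bijection, which gives full faithfulness. -/
instance : D.functor.IsEquivalence where
  faithful := ⟨fun {V W f g} h => by
    have h' := congrArg (fun f : D.functor.obj V ⟶ D.functor.obj W => lin f) h
    exact Hom.ext h'⟩
  full := ⟨fun {V W} (f : D.obj V ⟶ D.obj W) => ⟨mkHom (V := V) (W := W)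
      (lin (V := D.obj V) (W := D.obj W) f) fun x v hv => by
    obtain ⟨y, hy, h⟩ := D.exists_isDeg_of_obj ((D.isDeg_obj hv).lin f)
    rw [← D.F.injective hy]
    exact h, rfl⟩⟩
  -- A preimage of `W` is obtained by regrading along the inverse bijection. Regrading back returns
  -- the same space and the same components, so the identity map is the isomorphism.
  essSurj := ⟨fun W => ⟨regradeObj (omega ξ) D.F.symm.toEquiv W, ⟨by
    have key : ∀ x, W.proj (D.F (D.F.symm x)) = W.proj x := fun x => by
      rw [D.F.apply_symm_apply]
    exact
      { hom := ⟨LinearMap.id, fun x v => LinearMap.congr_fun (key x).symm v⟩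
        inv := ⟨LinearMap.id, fun x v => LinearMap.congr_fun (key x) v⟩
        hom_inv_id := rfl
        inv_hom_id := rfl }⟩⟩⟩

/-- The isomorphism `1 ≅ F 1`. -/
def unitIso : one (omega ξ') ≅ D.obj (one (omega ξ)) :=
  mkIso
    (mkHom (W := D.obj (one (omega ξ)))
      ((D.η 1 1 : K) • (LinearMap.id : one (omega ξ) →ₗ[K] one (omega ξ))) fun x a ha => by
        by_cases e : x = 1
        · subst e
          have := D.isDeg_obj (((isDeg_one (ω := omega ξ) a)).smul (D.η 1 1 : K))
          rw [map_one] at this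
          exact this
        · rw [isDeg_one_ne e ha]; simp [IsDeg])
    (mkHom (V := D.obj (one (omega ξ))) (W := one (omega ξ'))
      (((D.η 1 1)⁻¹ : K) • (LinearMap.id : one (omega ξ) →ₗ[K] one (omega ξ)))
      fun x a ha => by
        obtain ⟨y, rfl, hy⟩ := D.exists_isDeg_of_obj ha
        by_cases e : y = 1
        · subst e
          rw [map_one]
          exact (isDeg_one (ω := omega ξ') a).smul _
        · have : a = 0 := isDeg_one_ne e hy
          subst this
          simp [IsDeg])
    (fun x a _ => by
      change ((D.η 1 1)⁻¹ : K) • (D.η 1 1 : K) • a = a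
      rw [smul_smul]; simp)
    (fun x a _ => by
      change (D.η 1 1 : K) • ((D.η 1 1)⁻¹ : K) • a = a
      rw [smul_smul]; simp)

/-- The isomorphism `F V ⊗ F W ≅ F (V ⊗ W)`, inverse to `η(x,y) id`. -/
def tensorIso (V W : VecTw (omega ξ)) :
    tensor (D.obj V) (D.obj W) ≅ D.obj (tensor V W) where
  hom := mkHom₂ (V := D.obj V) (W := D.obj W) (Z := D.obj (tensor V W))
    (scal₂ (fun x y => (D.η x y)⁻¹) V W) fun x v y w hv hw => by
      obtain ⟨x, rfl, hv'⟩ := D.exists_isDeg_of_obj hv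
      obtain ⟨y, rfl, hw'⟩ := D.exists_isDeg_of_obj hw
      rw [scal₂_apply (V := V) (W := W) _ hv' hw', ← map_mul]
      exact (D.isDeg_obj (isDeg_tmul hv' hw')).smul _
  inv := ⟨scal₂ D.η V W, fun z t => LinearMap.congr_fun
    (f := (tensor (D.obj V) (D.obj W)).proj z ∘ₗ scal₂ D.η V W)
    (g := scal₂ D.η V W ∘ₗ (D.obj (tensor V W)).proj z)
    (ext₂ fun x v y w hv hw => by
      refine comm_at (V := D.obj (tensor V W))
        (W := tensor (D.obj V) (D.obj W))
        (D.isDeg_obj (isDeg_tmul hv hw)) ?_ z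
      rw [scal₂_apply _ hv hw, map_mul]
      exact (isDeg_tmul (D.isDeg_obj hv) (D.isDeg_obj hw)).smul _) t⟩
  hom_inv_id := Hom.ext (LinearMap.ext fun t => scal₂_apply_inv (V := V) (W := W) D.η t)
  inv_hom_id := Hom.ext (LinearMap.ext fun t => scal₂_inv_apply (V := V) (W := W) D.η t)

/-- The relation `omega_eq` at `(1, 1, x)` contains `η(1,x)` on both sides; cancelling it leaves the
scalar identity for the left unit constraint. The right one arises in the same way from `(x, 1, 1)`.
-/
theorem η_one_left (x : X) :
    (D.η 1 x : K) * (omega ξ).1 1 1 x = (omega ξ').1 1 1 (D.F x) * D.η 1 1 := by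
  have h := D.omega_eq 1 1 x
  simp only [one_mul, map_one] at h
  exact mul_left_cancel₀ (D.η 1 x).ne_zero (by linear_combination -h)

theorem η_one_right (x : X) :
    (D.η 1 1 : K) * (omega ξ).1 x 1 1 = (omega ξ').1 (D.F x) 1 1 * D.η x 1 := by
  have h := D.omega_eq x 1 1
  simp only [mul_one, map_one] at h
  exact mul_left_cancel₀ (D.η x 1).ne_zero (by linear_combination -h)

/-- The maps `F V ⊗ F W ⟶ F (V ⊗ W)` carry the scalar `η⁻¹`, so that `δ` carries `η`. Associativity
is then `omega_eq`, and the unit laws are `η_one_left` and `η_one_right`. -/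
instance monoidal : D.functor.Monoidal :=
  Functor.CoreMonoidal.toMonoidal
  { εIso := D.unitIso
    μIso := D.tensorIso
    μIso_hom_natural_left := fun {V V'} φ W => Hom.ext (ext₂ (V := V) (W := W) fun x v y w hv hw => by
      change scal₂ (fun x y => (D.η x y)⁻¹) V' W (lin φ v ⊗ₜ w) =
        TensorProduct.map (lin φ) LinearMap.id
          (scal₂ (fun x y => (D.η x y)⁻¹) V W (v ⊗ₜ w))
      rw [scal₂_apply _ hv hw, scal₂_apply _ (hv.lin φ) hw, map_smul]; rfl)
    μIso_hom_natural_right := fun {W W'} V φ => Hom.ext (ext₂ (V := V) (W := W) fun x v y w hv hw => by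
      change scal₂ (fun x y => (D.η x y)⁻¹) V W' (v ⊗ₜ lin φ w) =
        TensorProduct.map LinearMap.id (lin φ)
          (scal₂ (fun x y => (D.η x y)⁻¹) V W (v ⊗ₜ w))
      rw [scal₂_apply _ hv hw, scal₂_apply _ hv (hw.lin φ), map_smul]; rfl)
    associativity := fun U V W => Hom.ext (ext₃ (U := U) (V := V) (W := W) fun x u y v z w hu hv hw => by
      change assocLin U V W (scal₂ (fun x y => (D.η x y)⁻¹) (tensor U V) W
          (scal₂ (fun x y => (D.η x y)⁻¹) U V (u ⊗ₜ v) ⊗ₜ w)) =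
        scal₂ (fun x y => (D.η x y)⁻¹) U (tensor V W) (TensorProduct.map LinearMap.id
          (scal₂ (fun x y => (D.η x y)⁻¹) V W)
            (assocLin (D.obj U) (D.obj V) (D.obj W) ((u ⊗ₜ v) ⊗ₜ w)))
      rw [assocLin_apply (D.isDeg_obj hu) (D.isDeg_obj hv) (D.isDeg_obj hw)]
      rw [map_smul, map_smul,
        TensorProduct.map_tmul, scal₂_apply _ hu hv, scal₂_apply _ hv hw,
        ← TensorProduct.smul_tmul', map_smul, map_smul, TensorProduct.tmul_smul, map_smul,
        LinearMap.id_apply, scal₂_apply _ (isDeg_tmul hu hv) hw, scal₂_apply _ hu (isDeg_tmul hv hw),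
        map_smul, assocLin_apply hu hv hw]
      simp only [smul_smul, Units.val_inv_eq_inv_val]
      congr 1
      have := D.omega_eq x y z
      field_simp
      linear_combination -this)
    left_unitality := fun V => Hom.ext (ext₂ (V := one (omega ξ')) (W := D.obj V)
      fun x a y' v ha hv' => by
      -- The unit object lives in degree `1`, so in any other degree the vector `a` is zero and both
      -- sides vanish.
      by_cases e : x = 1
      · obtain ⟨y, rfl, hv⟩ := D.exists_isDeg_of_obj hv'
        subst e
        change lin (leftUnit (D.obj V)).hom (a ⊗ₜ[K] v) =
          lin (leftUnit V).hom (scal₂ (fun x y => (D.η x y)⁻¹) (one (omega ξ)) V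
            (((D.η 1 1 : K) • (show K from a)) ⊗ₜ[K] v))
        rw [leftUnit_hom_apply a hv']
        rw [scal₂_apply (V := one (omega ξ)) (W := V) _ (isDeg_one (ω := omega ξ) _) hv]
        rw [map_smul, leftUnit_hom_apply (V := V) _ hv]
        simp only [smul_smul, Units.val_inv_eq_inv_val, smul_eq_mul]
        congr 1
        have := D.η_one_left y
        field_simp
        linear_combination a * this
      · rw [isDeg_one_ne e ha, TensorProduct.zero_tmul]
        exact (map_zero _).trans (map_zero _).symm)
    right_unitality := fun V => Hom.ext (ext₂ (V := D.obj V) (W := one (omega ξ'))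
      fun x' v y a hv' ha => by
      by_cases e : y = 1
      · obtain ⟨x, rfl, hv⟩ := D.exists_isDeg_of_obj hv'
        subst e
        change lin (rightUnit (D.obj V)).hom (v ⊗ₜ[K] a) =
          lin (rightUnit V).hom (scal₂ (fun x y => (D.η x y)⁻¹) V (one (omega ξ))
            (v ⊗ₜ[K] ((D.η 1 1 : K) • (show K from a))))
        rw [rightUnit_hom_apply a hv']
        rw [scal₂_apply (V := V) (W := one (omega ξ)) _ hv (isDeg_one (ω := omega ξ) _)]
        rw [map_smul, rightUnit_hom_apply (V := V) _ hv]
        simp only [smul_smul, Units.val_inv_eq_inv_val, smul_eq_mul]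
        congr 1
        have := D.η_one_right x
        field_simp
        linear_combination -a * this
      · rw [isDeg_one_ne e ha, TensorProduct.tmul_zero]
        exact (map_zero _).trans (map_zero _).symm) }

theorem lin_functor_map (f : V ⟶ W) (v : V) :
    lin (D.functor.map f) (D.inF v) = D.inF (lin f v) := rfl

theorem inF_smul (a : K) (v : V) : D.inF (a • v) = a • D.inF v := rfl

theorem lin_functor_δ {x y : X} {v : V} {w : W} (hv : V.IsDeg x v) (hw : W.IsDeg y w) :
    lin (δ D.functor V W) (D.inF (tm v w)) = (D.η x y : K) • tm (D.inF v) (D.inF w) :=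
  scal₂_apply _ hv hw

/-- The isomorphism `F T_g ≅ T'_{f(g)} F` given by `b g`. -/
def βIso (g : G) : (crossedPointed ξ).T g ⋙ D.functor ≅ D.functor ⋙ (crossedPointed ξ').T (D.f g) :=
  NatIso.ofComponents
    (fun V => mkIso
      (mkHom (V := D.obj (tObj ξ g V)) (W := tObj ξ' (D.f g) (D.obj V))
        (scal₁ (D.b g) V) fun x v hv => by
          obtain ⟨y, rfl, hv'⟩ := D.exists_isDeg_of_obj hv
          obtain ⟨z, rfl, hv''⟩ := exists_isDeg_of_tObj _ hv'
          rw [scal₁_apply (V := V) _ hv'', D.act_comm]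
          exact (isDeg_tObj (D.f g) (D.isDeg_obj hv'')).smul _)
      (mkHom (V := tObj ξ' (D.f g) (D.obj V)) (W := D.obj (tObj ξ g V))
        (scal₁ (fun x => (D.b g x)⁻¹) V) fun x v hv => by
          obtain ⟨y, rfl, hv'⟩ := exists_isDeg_of_tObj _ hv
          obtain ⟨z, rfl, hv''⟩ := D.exists_isDeg_of_obj hv'
          rw [scal₁_apply (V := V) _ hv'', ← D.act_comm]
          exact (D.isDeg_obj (isDeg_tObj g hv'')).smul _)
      (fun _ v _ => scal₁_inv_apply (V := V) (D.b g) v)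
      (fun _ v _ => scal₁_apply_inv (V := V) (D.b g) v))
    (fun {V W} φ => Hom.ext (LinearMap.ext fun v => scal₁_lin (D.b g) φ v))

theorem lin_βIso (g : G) {x : X} {v : V} (hv : V.IsDeg x v) :
    lin ((D.βIso g).hom.app V) (D.inF (inT g v)) = (D.b g x : K) • inT (D.f g) (D.inF v) :=
  scal₁_apply _ hv

/-- Taking `x = y = 1` in `mu_eq` and cancelling `b_g(1) η(1,1)` gives the compatibility of `β_g`
with the unit structures. -/
theorem mu_one (g : G) : (mu ξ' (D.f g) 1 1 : K) = mu ξ g 1 1 * D.b g 1 := by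
  have h := D.mu_eq g 1 1
  simp only [map_one, mul_one] at h
  refine mul_right_cancel₀ (mul_ne_zero (D.b g 1).ne_zero (D.η 1 1).ne_zero) (h.trans ?_)
  ring

theorem βIso_monoidal (g : G) : NatTrans.IsMonoidal (D.βIso g).hom where
  unit := Hom.ext (LinearMap.ext fun (a : K) => by
    change scal₁ (D.b g) (one (omega ξ)) ((mu ξ g 1 1 : K) • (D.η 1 1 : K) • a) =
      (D.η 1 1 : K) • (mu ξ' (D.f g) 1 1 : K) • a
    rw [scal₁_apply _ (isDeg_one (ω := omega ξ) _), D.mu_one]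
    simp only [smul_eq_mul]
    ring)
  tensor V W := Hom.ext (ext₂ (V := V) (W := W) fun x v y w hv hw => by
    change scal₁ (D.b g) (tensor V W) (scal₂ (fun x y => (mu ξ g x y)⁻¹) V W
        (scal₂ (fun x y => (D.η x y)⁻¹) (tObj ξ g V) (tObj ξ g W) (v ⊗ₜ w))) =
      scal₂ (fun x y => (D.η x y)⁻¹) V W
        (scal₂ (fun x y => (mu ξ' (D.f g) x y)⁻¹) (D.obj V) (D.obj W)
          (scal₁ (D.b g) V v ⊗ₜ scal₁ (D.b g) W w))
    rw [scal₂_apply (V := tObj ξ g V) (W := tObj ξ g W) _ (isDeg_tObj g hv) (isDeg_tObj g hw),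
      map_smul, map_smul, scal₂_apply _ hv hw, map_smul, scal₁_apply _ (isDeg_tmul hv hw),
      scal₁_apply _ hv, scal₁_apply _ hw, scal₂_apply (V := D.obj V) (W := D.obj W) _
        (D.isDeg_obj (hv.smul _)) (D.isDeg_obj (hw.smul _)), map_smul,
      scal₂_apply _ (hv.smul _) (hw.smul _), ← TensorProduct.smul_tmul', TensorProduct.tmul_smul]
    simp only [smul_smul, Units.val_inv_eq_inv_val]
    congr 1
    have := D.mu_eq g x y
    field_simp
    linear_combination this)

theorem map_grade {g : G} (hV : (crossedPointed ξ).grade g V) :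
    (crossedPointed ξ').grade (D.f g) (D.functor.obj V) := by
  refine tGrade_iff.2 fun x v hv hx => ?_
  obtain ⟨y, rfl, hv'⟩ := D.exists_isDeg_of_obj hv
  refine tGrade_iff.1 hV y v hv' fun h => hx ?_
  rw [D.bd_comm, h]

theorem map_braid {g : G} (hV : (crossedPointed ξ).grade g V) (W : VecTw (omega ξ)) :
    D.functor.map ((crossedPointed ξ).braid hV W).hom ≫
        δ D.functor (((crossedPointed ξ).T g).obj W) V ≫
          (D.βIso g).hom.app W ▷ D.functor.obj V =
      δ D.functor V W ≫ ((crossedPointed ξ').braid (D.map_grade hV) (D.functor.obj W)).hom :=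
  Hom.ext (ext₂ (V := V) (W := W) fun x v y w hv hw => by
    -- Either the degree `x` of `v` lies over `g`, so that `g` may be replaced by `∂ x`, or `v = 0`
    -- and there is nothing to compare.
    rcases bd_eq_or hV hv with rfl | rfl
    · change lin ((D.βIso _).hom.app W ▷ D.functor.obj V) (lin (δ D.functor _ V)
          (lin (D.functor.map ((crossedPointed ξ).braid hV W).hom) (D.inF (tm v w)))) =
        lin ((crossedPointed ξ').braid (D.map_grade hV) (D.functor.obj W)).hom
          (lin (δ D.functor V W) (D.inF (tm v w)))
      rw [lin_functor_map, lin_braid hV hv hw, inF_smul, map_smul,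
        D.lin_functor_δ (isDeg_inT _ hw) hv, D.lin_functor_δ hv hw, map_smul, map_smul, map_smul,
        lin_braid (D.map_grade hV) (D.isDeg_inF hv) (D.isDeg_inF hw)]
      have h1 : lin ((D.βIso (𝒳.bd x)).hom.app W ▷ D.functor.obj V)
          (tm (D.inF (inT (𝒳.bd x) w)) (D.inF v)) =
          (D.b (𝒳.bd x) y : K) • tm (inT (D.f (𝒳.bd x)) (D.inF w)) (D.inF v) := by
        rw [← smul_tm, ← D.lin_βIso (𝒳.bd x) hw]
        rfl
      refine Eq.trans (congrArg (fun t => (cc ξ x y : K) •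
        (D.η (𝒳.act (𝒳.bd x) y) x : K) • t) h1) ?_
      simp only [smul_smul]
      congr 1
      rw [𝒳.act_bd]
      -- After the action of `∂ x` is written as conjugation by `x`, the required equality of
      -- scalars is the relation for `c`.
      linear_combination -D.cc_eq x y
    · rw [TensorProduct.zero_tmul]; exact (map_zero _).trans (map_zero _).symm)

theorem map_γ (g h : G) (V : VecTw (omega ξ)) :
    D.functor.map (((crossedPointed ξ).γ g h).hom.app V) ≫
        (D.βIso g).hom.app (((crossedPointed ξ).T h).obj V) ≫
        ((crossedPointed ξ').T (D.f g)).map ((D.βIso h).hom.app V) =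
      (D.βIso (g * h)).hom.app V ≫
        (transport (crossedPointed ξ').T (map_mul D.f g h)).app (D.functor.obj V) ≫
        ((crossedPointed ξ').γ (D.f g) (D.f h)).hom.app (D.functor.obj V) :=
  Hom.ext (lin_ext (V := V) fun x v hv => by
    have h1 := lin_transport_T (ξ := ξ') (map_mul D.f g h)
      (D.inF (scal₁ (D.b (g * h)) V v))
    -- The transport along `f (g * h) = f g * f h` fixes the vector and can be removed; what remains
    -- is a comparison of scalars.
    refine Eq.trans ?_ (congrArg (lin (γApp ξ' (D.f g) (D.f h) (D.functor.obj V))) h1).symm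
    change scal₁ (D.b h) V (scal₁ (D.b g) (tObj ξ h V) (scal₁ (gamma ξ g h) V v)) =
      scal₁ (gamma ξ' (D.f g) (D.f h)) (D.obj V) (scal₁ (D.b (g * h)) V v)
    rw [scal₁_apply _ hv, scal₁_apply _ hv, map_smul, map_smul, map_smul,
      scal₁_apply (V := tObj ξ h V) _ (isDeg_tObj h hv), map_smul, scal₁_apply _ hv,
      scal₁_apply (V := D.obj V) _ (D.isDeg_obj hv)]
    simp only [smul_smul]
    congr 1
    linear_combination -D.gamma_eq g h x)

/-- The crossed functor given by a comparison of cocycles. -/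
def crossedFunctor : CrossedFunctor (crossedPointed ξ) (crossedPointed ξ') where
  f := D.f
  F := D.functor
  β := D.βIso
  β_monoidal := D.βIso_monoidal
  map_grade := D.map_grade
  map_braid := D.map_braid
  map_γ := D.map_γ

end Comparison

/-- The equality of cochains, cleared of denominators component by component, is a `Comparison`.
Bijectivity of `F` makes the regrading functor an equivalence, while bijectivity of `f` is the other
half of being a crossed equivalence. -/
theorem equivalent_of_iso {ξ : Z3qa K 𝒳} {ξ' : Z3qa K 𝒳'} (φ : CrossedModule.Hom 𝒳 𝒳')
    (hφ : φ.IsIso) (p : (X → X → Kˣ) × (G → X → Kˣ))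
    (hp : (pullback K φ ξ').1 = ξ.1 * qaCoboundary K 𝒳 p) :
    (crossedPointed ξ).Equivalent (crossedPointed ξ') := by
  let D : Comparison ξ ξ' :=
    { f := φ.f
      F := MulEquiv.ofBijective φ.F hφ.2
      bd_comm := φ.bd_comm
      act_comm := φ.act_comm
      η := p.1
      b := p.2
      omega_eq := fun x y z => by
        have h := congrArg (fun q => (q.1 x y z : K)) hp
        simp only [pullback, qaCoboundary, MonoidHom.coe_mk, OneHom.coe_mk, Prod.fst_mul,
          Pi.mul_apply, Units.val_mul, Units.val_div_eq_div_val] at h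
        simp only [MulEquiv.ofBijective_apply]
        rw [h]
        field_simp
      gamma_eq := fun g k x => by
        have h := congrArg (fun q => (q.2.1 g k x : K)) hp
        simp only [pullback, qaCoboundary, MonoidHom.coe_mk, OneHom.coe_mk, Prod.fst_mul,
          Prod.snd_mul, Pi.mul_apply, Units.val_mul, Units.val_div_eq_div_val] at h
        simp only [MulEquiv.ofBijective_apply]
        rw [h]
        field_simp
      mu_eq := fun g x y => by
        have h := congrArg (fun q => (q.2.2.1 g x y : K)) hp
        simp only [pullback, qaCoboundary, MonoidHom.coe_mk, OneHom.coe_mk, Prod.fst_mul,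
          Prod.snd_mul, Pi.mul_apply, Units.val_mul, Units.val_div_eq_div_val] at h
        simp only [MulEquiv.ofBijective_apply]
        rw [h]
        field_simp
      cc_eq := fun x y => by
        have h := congrArg (fun q => (q.2.2.2 x y : K)) hp
        simp only [pullback, qaCoboundary, MonoidHom.coe_mk, OneHom.coe_mk,
          Prod.snd_mul, Pi.mul_apply, Units.val_mul, Units.val_div_eq_div_val] at h
        simp only [MulEquiv.ofBijective_apply]
        rw [h]
        field_simp }
  exact ⟨D.crossedFunctor, hφ.1, inferInstanceAs D.functor.IsEquivalence⟩

end CrossedPointed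
end

/-! ### The classification of crossed pointed categories up to equivalence -/

theorem mainTheorem6
    {K : Type*} [Field K] [IsAlgClosed K] [CharZero K]
    {G X G' X' : Type*} [Group G] [Finite G] [Group X] [Fintype X]
    [Group G'] [Finite G'] [Group X'] [Fintype X']
    {𝒳 : CrossedModule G X} {𝒳' : CrossedModule G' X'}
    (ξ : Z3qa K 𝒳) (ξ' : Z3qa K 𝒳') :
    (crossedPointed ξ).Equivalent (crossedPointed ξ') ↔
      ∃ φ : CrossedModule.Hom 𝒳 𝒳', φ.IsIso ∧
        (QuotientGroup.mk (pullback K φ ξ') : H3qa K 𝒳) = QuotientGroup.mk ξ := by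
  -- Equality of the cosets says that the quotient of the two cocycles lies in the range of
  -- `qaCoboundary`. Unpacking the range yields the cochain pair `p` that both directions work with.
  have key : ∀ φ : CrossedModule.Hom 𝒳 𝒳',
      (QuotientGroup.mk (pullback K φ ξ') : H3qa K 𝒳) = QuotientGroup.mk ξ ↔
        ∃ p, (pullback K φ ξ').1 = ξ.1 * qaCoboundary K 𝒳 p := fun φ => by
    rw [eq_comm, QuotientGroup.eq, Subgroup.mem_subgroupOf]
    refine exists_congr fun p => ?_
    rw [Subgroup.coe_mul, Subgroup.coe_inv, eq_inv_mul_iff_mul_eq, eq_comm]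
  constructor
  · rintro ⟨Φ, hΦ⟩
    obtain ⟨φ, hφ, h⟩ := CrossedPointed.exists_iso_of_equivalence hΦ
    exact ⟨φ, hφ, (key φ).2 h⟩
  · rintro ⟨φ, hφ, h⟩
    obtain ⟨p, hp⟩ := (key φ).1 h
    exact CrossedPointed.equivalent_of_iso φ hφ p hp
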